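/- **Setting.** Let $M,N\ge 1$ be integers with $2N>M$, let $0<r_0\le r_1<r$, $\alpha>0$, $\lambda_I\ge 0$, $\rho_I\ge 0$, and assume $\alpha>2$ if $\rho_I>0$. Put $L(d)=d^\alpha$ for $d>r_0$ and $L(d)=r_0^\alpha$ otherwise. A base station with $M$ antennas at the origin of $\mathbb R^2$ serves $M$ pairs of users with $N$ antennas each; pair $i$ consists of a near user $i$, uniformly distributed in the disc of radius $r_1$ around the origin, and a far user $i'$, uniformly distributed in the ring between the radii $r_1$ and $r$. The fading matrices $\mathbf G_i,\mathbf G_{i'}\in\mathbb C^{N\times M}$ have i.i.d. $\mathrm{CN}(0,1)$ entries, the interferers form a homogeneous Poisson point process $\Psi_I$ of density $\lambda_I$ on $\mathbb R^2$, and the vectors $\mathbf x_i\in\mathbb C^{2N-M}$ (random detection) are uniformly distributed on the sphere $|\mathbf x|^2=2$; all user locations, fading matrices, $\Psi_I$ and all $\mathbf x_i$ are independent. Let $\mathbf U_i$ be a $2N\times(2N-M)$ matrix, depending measurably on $(\mathbf G_i,\mathbf G_{i'})$, whose columns are orthonormal and lie in the null space of $[\mathbf G_i^H\ \ -\mathbf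 G_{i'}^H]$. The detection vectors $\mathbf v_i,\mathbf v_{i'}\in\mathbb C^N$ are the upper and lower half of $\mathbf U_i\mathbf x_i$; put $\mathbf g_i=\mathbf G_i^H\mathbf v_i$ and $\mathbf G=[\mathbf g_1\cdots\mathbf g_M]$. For a pair $m$ let $d_{m'}$ be the distance of user $m'$ from the origin and $$h_{m'}=\frac1{\sqrt{L(d_{m'})\,(\mathbf G^{-1}\mathbf G^{-H})_{m,m}}},\qquad I_{m'}=\sum_{j\in\Psi_I}\frac{\rho_I}{L(d_{I_j,m'})},$$ where $d_{I_j,m'}$ is the distance from user $m'$ to the interferer $j$. Let $\alpha_m,\alpha_{m'}$ be real constants (fixed power allocation) with $\alpha_m^2+\alpha_{m'}^2=1$, let $R_{m'}>0$ and $\epsilon_{m'}=2^{R_{m'}}-1$. For a transmit SNR $\rho>0$ the outage probability of user $m'$ is $$\mathrm P^o_{m'}(\rho)=\mathrm P\Bigl(\log_2\Bigl(1+\frac{\rho|h_{m'}|^2\alpha_{m'}^2}{\rho|h_{m'}|^2\alpha_m^2+|\mathbf v_{m'}|^2+|\mathbf v_{m'}^H\mathbf 1_N|^2I_{m'}}\Bigr)<R_{m'}\Bigr),$$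 where $\mathbf 1_N$ is the all-one vector, and for $\delta\ge0$ the modified outage probability is $$\tilde{\mathrm P}_{m'}(\rho)=\mathrm P\Bigl(\log_2\Bigl(1+\frac{\rho|h_{m'}|^2\alpha_{m'}^2}{\rho|h_{m'}|^2\alpha_m^2+2+2\delta I_{m'}}\Bigr)<R_{m'}\Bigr).$$ An outage probability $\mathrm P(\rho)$ has diversity order $d$ if $\mathrm P(\rho)>0$ for all large $\rho$ and $-\log\mathrm P(\rho)/\log\rho\to d$ as $\rho\to\infty$, all other parameters being fixed. **Corollary.** If $\alpha_{m'}^2>\alpha_m^2\epsilon_{m'}$, then the far user $m'$ achieves diversity order exactly one: $\mathrm P^o_{m'}$ has diversity order $1$, and so has $\tilde{\mathrm P}_{m'}$ for every $\delta\ge0$. -/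

import Mathlib

open MeasureTheory ProbabilityTheory Filter Topology
open scoped ENNReal NNReal Matrix

namespace MimoNoma

noncomputable section

/-- The plane in which users and interferers live; the base station is at the origin. -/
abbrev Plane : Type := EuclideanSpace ℝ (Fin 2)

/-- A channel matrix from a base station with `M` antennas to a user with `N` antennas. -/
abbrev Channel (N M : ℕ) : Type := Matrix (Fin N) (Fin M) ℂ

/-- Matrices carry the product σ-algebra of their entries. -/
instance instMeasurableSpaceMatrix {m n : Type*} : MeasurableSpace (Matrix m n ℂ) :=
  inferInstanceAs (MeasurableSpace (m → n → ℂ))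

/-! ### Laws of the random quantities -/

/-- The circularly symmetric complex Gaussian law `CN(0,1)`: independent real and imaginary
parts, each `N(0,1/2)`. -/
def complexGaussian : Measure ℂ :=
  ((gaussianReal 0 2⁻¹).prod (gaussianReal 0 2⁻¹)).map fun p : ℝ × ℝ => (⟨p.1, p.2⟩ : ℂ)

/-- Rayleigh fading: an `N × M` matrix with i.i.d. `CN(0,1)` entries. -/
def rayleigh (N M : ℕ) : Measure (Channel N M) :=
  Measure.pi fun _ : Fin N => Measure.pi fun _ : Fin M => complexGaussian

/-- Squared Euclidean norm of a complex vector. -/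
def normSq {ι : Type*} [Fintype ι] (v : ι → ℂ) : ℝ := ∑ i, ‖v i‖ ^ 2

/-- The uniform law on the sphere `|x|² = 2` of `ℂᵏ`, as the law of a normalized standard
complex Gaussian vector. -/
def uniformSphere (k : ℕ) : Measure (Fin k → ℂ) :=
  (Measure.pi fun _ : Fin k => complexGaussian).map fun z i =>
    ((√2 / √(normSq z) : ℝ) : ℂ) * z i

/-- The inner disc `D₁`. -/
def innerDisc (r₁ : ℝ) : Set Plane := Metric.closedBall 0 r₁

/-- The ring `D₂ = D \ D₁`. -/
def outerRing (r₁ r : ℝ) : Set Plane := Metric.closedBall 0 r \ Metric.closedBall 0 r₁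

/-- The counting measure of the points of `S`. -/
def points (S : Set Plane) : Measure Plane := Measure.sum fun y : S => Measure.dirac (y : Plane)

/-- `Ψ` is a homogeneous Poisson point process of density `lam` on the plane: the number of points
in a set of finite area `A` is Poisson with mean `lam * A`, and the numbers of points in disjoint
sets are independent. -/
structure IsPoissonProcess {Ω : Type*} [MeasurableSpace Ω] (μ : Measure Ω) (lam : ℝ≥0)
    (Ψ : Ω → Set Plane) : Prop where
  measurable : Measurable fun ω => points (Ψ ω)
  count_law : ∀ B : Set Plane, MeasurableSet B → volume B ≠ ∞ →
    HasLaw (fun ω => points (Ψ ω) B)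
      ((poissonMeasure (lam * (volume B).toNNReal)).map fun n : ℕ => (n : ℝ≥0∞)) μ
  indep : ∀ (n : ℕ) (B : Fin n → Set Plane), (∀ i, MeasurableSet (B i)) →
    (∀ i j, i ≠ j → Disjoint (B i) (B j)) → iIndepFun (fun i ω => points (Ψ ω) (B i)) μ

/-! ### Signal alignment and zero forcing -/

/-- A rule that assigns to the two channel matrices `A = G_m`, `A' = G_{m'}` of a pair a matrix
`U_m` whose `2N - M` columns are orthonormal and lie in the null space of `[Aᴴ  -A'ᴴ]`, i.e. are
right singular vectors of that matrix for the singular value zero. -/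
structure IsAlignment {M N : ℕ}
    (U : Channel N M → Channel N M → Matrix (Fin N ⊕ Fin N) (Fin (2 * N - M)) ℂ) : Prop where
  measurable : Measurable fun q : Channel N M × Channel N M => U q.1 q.2
  orthonormal : ∀ A A', (U A A')ᴴ * U A A' = 1
  null : ∀ A A', Matrix.fromCols Aᴴ (-A'ᴴ) * U A A' = 0

section Scheme

variable {M N : ℕ}
  (U : Fin M → Channel N M → Channel N M → Matrix (Fin N ⊕ Fin N) (Fin (2 * N - M)) ℂ)
  (G G' : Fin M → Channel N M) (x : Fin M → Fin (2 * N - M) → ℂ)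

/-- Detection vector `v_i` of the near user of pair `i`: the upper half of `U_i x_i`. -/
def nearVec (i : Fin M) : Fin N → ℂ := fun n => (U i (G i) (G' i) *ᵥ x i) (Sum.inl n)

/-- Detection vector `v_{i'}` of the far user of pair `i`: the lower half of `U_i x_i`. -/
def farVec (i : Fin M) : Fin N → ℂ := fun n => (U i (G i) (G' i) *ᵥ x i) (Sum.inr n)

/-- The effective channel vector `g_i = G_iᴴ v_i` shared by the two users of pair `i`. -/
def effVec (i : Fin M) : Fin M → ℂ := (G i)ᴴ *ᵥ nearVec U G G' x i

/-- The effective channel matrix `[g_1 ⋯ g_M]`, with columns `g_i`; the zero-forcing precoder is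
`(effMatrix)⁻ᴴ D`. -/
def effMatrix : Matrix (Fin M) (Fin M) ℂ := Matrix.of fun j i => effVec U G G' x i j

/-- `(G⁻¹ G⁻ᴴ)_{m,m}`, a nonnegative real number. -/
def zfDiag (m : Fin M) : ℝ :=
  ((effMatrix U G G' x)⁻¹ * ((effMatrix U G G' x)⁻¹)ᴴ) m m |>.re

end Scheme

/-- Bounded path loss with exponent `α`. -/
def pathLoss (r₀ α d : ℝ) : ℝ := if r₀ < d then d ^ α else r₀ ^ α

/-- The scalar channel gain `h = 1 / √(L(d) (G⁻¹ G⁻ᴴ)_{m,m})`. -/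
def scalarGain (r₀ α d z : ℝ) : ℝ := 1 / √(pathLoss r₀ α d * z)

/-- Interference at the location `p`: the sum of `ρI / L(distance)` over the interferers, as an
extended nonnegative number. -/
def interference (r₀ α ρI : ℝ) (S : Set Plane) (p : Plane) : ℝ≥0∞ :=
  ∑' y : S, ENNReal.ofReal (ρI / pathLoss r₀ α (dist p y))

/-- SINR of the far user, with channel gain `h`, power allocation coefficients `a` (near user) and
`a'` (far user), and noise plus co-channel interference of power `w`. -/
def sinr (a a' ρ h w : ℝ) : ℝ := ρ * |h| ^ 2 * a' ^ 2 / (ρ * |h| ^ 2 * a ^ 2 + w)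

/-! ### The random system and its outage probabilities -/

/-- The random quantities of the downlink: fading matrices `G i`, `G' i`, locations `p i`, `p' i`
(near and far user of pair `i`), the vectors `x i` and the set `Ψ` of interferers. -/
structure Downlink (M N : ℕ) (Ω : Type*) where
  G : Ω → Fin M → Channel N M
  G' : Ω → Fin M → Channel N M
  p : Ω → Fin M → Plane
  p' : Ω → Fin M → Plane
  x : Ω → Fin M → Fin (2 * N - M) → ℂ
  Ψ : Ω → Set Plane

variable {M N : ℕ} {Ω : Type*}

/-- Everything except the interferers. -/
def Downlink.cell (S : Downlink M N Ω) (ω : Ω) :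
    (Fin M → Channel N M) × (Fin M → Channel N M) × (Fin M → Plane) × (Fin M → Plane) ×
      (Fin M → Fin (2 * N - M) → ℂ) :=
  (S.G ω, S.G' ω, S.p ω, S.p' ω, S.x ω)

/-- The distributional assumptions. All quantities are independent; the fading is Rayleigh, the
near users are uniform in `D₁`, the far users are uniform in `D₂`, the vectors `x i` are uniform on
the sphere `|x|² = 2`, and the interferers form a Poisson process. -/
structure Downlink.IsModel [MeasurableSpace Ω] (S : Downlink M N Ω) (μ : Measure Ω)
    (r₁ r : ℝ) (lam : ℝ≥0) : Prop where
  law : HasLaw S.cell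
    ((Measure.pi fun _ => rayleigh N M).prod <|
      (Measure.pi fun _ => rayleigh N M).prod <|
      (Measure.pi fun _ => (volume : Measure Plane)[|innerDisc r₁]).prod <|
      (Measure.pi fun _ => (volume : Measure Plane)[|outerRing r₁ r]).prod <|
      Measure.pi fun _ => uniformSphere (2 * N - M)) μ
  poisson : IsPoissonProcess μ lam S.Ψ
  indep : IndepFun S.cell (fun ω => points (S.Ψ ω)) μ

variable (S : Downlink M N Ω)
  (U : Fin M → Channel N M → Channel N M → Matrix (Fin N ⊕ Fin N) (Fin (2 * N - M)) ℂ)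

/-- The scalar channel `h_{m'}` of the far user of pair `m`. -/
def Downlink.farChannel (r₀ α : ℝ) (m : Fin M) (ω : Ω) : ℝ :=
  scalarGain r₀ α (dist (S.p' ω m) 0) (zfDiag U (S.G ω) (S.G' ω) (S.x ω) m)

/-- The interference `I_{m'}` at the far user of pair `m` (almost surely finite whenever `ρI = 0`
or `2 < α`). -/
def Downlink.farInterference (r₀ α ρI : ℝ) (m : Fin M) (ω : Ω) : ℝ :=
  (interference r₀ α ρI (S.Ψ ω) (S.p' ω m)).toReal

/-- The detection vector `v_{m'}` of the far user of pair `m`. -/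
def Downlink.farDetector (m : Fin M) (ω : Ω) : Fin N → ℂ :=
  farVec U (S.G ω) (S.G' ω) (S.x ω) m

/-- The outage probability `Pᵒ_{m'}` of the far user of pair `m` at transmit SNR `ρ`. -/
def Downlink.farOutage [MeasurableSpace Ω] (μ : Measure Ω) (r₀ α ρI a a' R : ℝ) (m : Fin M)
    (ρ : ℝ) : ℝ :=
  μ.real {ω | Real.logb 2 (1 + sinr a a' ρ (S.farChannel U r₀ α m ω)
    (normSq (S.farDetector U m ω) +
      ‖∑ n, star (S.farDetector U m ω n)‖ ^ 2 * S.farInterference r₀ α ρI m ω)) < R}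

/-- The modified outage probability `P̃_{m'}` with parameter `δ`, in which the noise plus
interference power is `2 + 2 δ I_{m'}`. -/
def Downlink.farOutageMod [MeasurableSpace Ω] (μ : Measure Ω) (r₀ α ρI a a' R δ : ℝ) (m : Fin M)
    (ρ : ℝ) : ℝ :=
  μ.real {ω | Real.logb 2 (1 + sinr a a' ρ (S.farChannel U r₀ α m ω)
    (2 + 2 * δ * S.farInterference r₀ α ρI m ω)) < R}

/-- An outage probability `P(ρ)` has diversity order `d` if it is positive at high SNR and
`- log P(ρ) / log ρ → d` as `ρ → ∞`. -/
def HasDiversityOrder (P : ℝ → ℝ) (d : ℝ) : Prop :=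
  (∀ᶠ ρ in atTop, 0 < P ρ) ∧ Tendsto (fun ρ => -Real.log (P ρ) / Real.log ρ) atTop (𝓝 d)

end

end MimoNoma

/-
The two stacked Gaussian channel matrices of a pair have a unitarily invariant law, so the frame
of their null space and the combined channel `g_i` behave like a unitarily invariant orthogonal
pair of vectors, which is compared with an explicit Gaussian pair. By Cramer's rule the
zero-forcing gain of pair `m` is `|c* g_m|² / |c|²`, where the cofactor vector `c` is independent
of pair `m`. Conditionally on `c`, this gain compares with the squared modulus of a complex
Gaussian: it is below a small multiple `s` of the noise power with probability at least of order
`s`, and its negative moments of every order `θ < 1` are finite.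

An outage of the far user is, up to constants, the event that the gain is at most the noise power
divided by `ρ`. The first estimate bounds its probability below by a multiple of `ρ⁻¹`. Campbell's
formula bounds the mean interference, which is independent of the gain, so Markov's inequality
gives an upper bound of order `ρ^(-θ)` for every `θ < 1`. Letting `θ → 1` squeezes
`-log P / log ρ` to `1`.
-/

namespace MimoNoma

section ComplexGaussian

theorem measurable_complex_mk : Measurable fun p : ℝ × ℝ => (⟨p.1, p.2⟩ : ℂ) :=
  Complex.measurableEquivRealProd.symm.measurable

instance isProbabilityMeasure_complexGaussian : IsProbabilityMeasure complexGaussian :=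
  Measure.isProbabilityMeasure_map measurable_complex_mk.aemeasurable

theorem gaussianPDFReal_mul_gaussianPDFReal (x y : ℝ) :
    gaussianPDFReal 0 2⁻¹ x * gaussianPDFReal 0 2⁻¹ y =
      Real.pi⁻¹ * Real.exp (-‖(⟨x, y⟩ : ℂ)‖ ^ 2) := by
  have hπ : (√Real.pi)⁻¹ * (√Real.pi)⁻¹ = Real.pi⁻¹ := by
    rw [← mul_inv, Real.mul_self_sqrt Real.pi_pos.le]
  have hvar : 2 * ((2⁻¹ : ℝ≥0) : ℝ) = 1 := by simp
  have hcoe : 2 * Real.pi * ((2⁻¹ : ℝ≥0) : ℝ) = Real.pi := by rw [mul_right_comm, hvar, one_mul]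
  have hnorm : -‖(⟨x, y⟩ : ℂ)‖ ^ 2 = -x ^ 2 + -y ^ 2 := by
    rw [← Complex.normSq_eq_norm_sq, Complex.normSq_apply]
    ring
  rw [gaussianPDFReal, gaussianPDFReal, hcoe, hvar, hnorm, Real.exp_add,
    sub_zero, sub_zero, div_one, div_one, mul_mul_mul_comm, hπ]

theorem complexGaussian_eq_withDensity :
    complexGaussian = volume.withDensity fun z : ℂ =>
      ENNReal.ofReal (Real.pi⁻¹ * Real.exp (-‖z‖ ^ 2)) := by
  refine Measure.ext_of_lintegral _ fun f hf => ?_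
  have hpdf : Measurable (gaussianPDF 0 2⁻¹) := measurable_gaussianPDF _ _
  have hf' : Measurable fun p : ℝ × ℝ => f ⟨p.1, p.2⟩ := hf.comp measurable_complex_mk
  rw [complexGaussian, lintegral_map hf measurable_complex_mk,
    gaussianReal_of_var_ne_zero 0 (by simp), prod_withDensity hpdf hpdf,
    lintegral_withDensity_eq_lintegral_mul _ (by fun_prop) hf',
    lintegral_withDensity_eq_lintegral_mul _ (by fun_prop) hf,
    ← Complex.volume_preserving_equiv_real_prod.symm.lintegral_comp (by fun_prop)]
  refine lintegral_congr fun p => ?_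
  simp only [Pi.mul_apply, Complex.measurableEquivRealProd_symm_apply,
    gaussianPDF, ← ENNReal.ofReal_mul (gaussianPDFReal_nonneg _ _ _),
    gaussianPDFReal_mul_gaussianPDFReal]

theorem volume_absolutelyContinuous_complexGaussian : volume ≪ complexGaussian := by
  rw [complexGaussian_eq_withDensity]
  refine withDensity_absolutelyContinuous' (by fun_prop) (ae_of_all _ fun z => ?_)
  have : 0 < Real.pi⁻¹ * Real.exp (-‖z‖ ^ 2) := by positivity
  simpa using this

theorem lintegral_normSq_rpow_neg_complexGaussian_lt_top {θ : ℝ} (hθ : θ < 1) :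
    ∫⁻ z, ENNReal.ofReal (‖z‖ ^ 2) ^ (-θ) ∂complexGaussian < ∞ := by
  have hint : Integrable fun z : ℂ => ‖z‖ ^ (-2 * θ) * Real.exp (-‖z‖ ^ (2 : ℝ)) := by
    refine .of_integral_ne_zero ?_
    rw [Complex.integral_rpow_mul_exp_neg_rpow one_le_two (by linarith)]
    have : 0 < Real.Gamma ((-2 * θ + 2) / 2) := Real.Gamma_pos_of_pos (by linarith)
    positivity
  rw [complexGaussian_eq_withDensity,
    lintegral_withDensity_eq_lintegral_mul _ (by fun_prop) (by fun_prop)]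
  refine lt_of_eq_of_lt (lintegral_congr_ae ?_) (hint.const_mul Real.pi⁻¹).lintegral_lt_top
  filter_upwards [compl_mem_ae_iff.2 (measure_singleton (0 : ℂ))] with z hz
  have hz : 0 < ‖z‖ := norm_pos_iff.2 hz
  simp only [Pi.mul_apply]
  rw [ENNReal.ofReal_rpow_of_pos (by positivity), ← ENNReal.ofReal_mul (by positivity),
    ← Real.rpow_natCast_mul hz.le, Real.rpow_two]
  congr 1
  push_cast
  rw [neg_mul, mul_neg]
  ring

theorem le_complexGaussian_setOf_norm_sq_lt {s : ℝ} (hs : 0 ≤ s) (hs₁ : s ≤ 1) :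
    ENNReal.ofReal (Real.exp (-1) * s) ≤ complexGaussian {z | ‖z‖ ^ 2 < s} := by
  have hball : {z : ℂ | ‖z‖ ^ 2 < s} = Metric.ball 0 √s := by
    ext z
    simp [Real.lt_sqrt (norm_nonneg z)]
  rw [hball, complexGaussian_eq_withDensity, withDensity_apply _ measurableSet_ball]
  calc ENNReal.ofReal (Real.exp (-1) * s)
      = ∫⁻ _ in Metric.ball (0 : ℂ) √s, ENNReal.ofReal (Real.pi⁻¹ * Real.exp (-1)) := by
        have hπ : (NNReal.pi : ℝ≥0∞) = ENNReal.ofReal Real.pi := by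
          rw [← NNReal.coe_real_pi, ENNReal.ofReal_coe_nnreal]
        rw [setLIntegral_const, Complex.volume_ball, hπ, ← ENNReal.ofReal_pow (Real.sqrt_nonneg s),
          Real.sq_sqrt hs, ← ENNReal.ofReal_mul hs, ← ENNReal.ofReal_mul (by positivity)]
        congr 1
        field_simp
    _ ≤ _ := by
        refine setLIntegral_mono (by fun_prop) fun z hz => ?_
        rw [mem_ball_zero_iff, Real.lt_sqrt (norm_nonneg z)] at hz
        gcongr
        exact hz.le.trans hs₁

theorem complexGaussian_setOf_one_le_norm_sq_pos : 0 < complexGaussian {z | 1 ≤ ‖z‖ ^ 2} := by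
  have hball : Metric.ball (2 : ℂ) 1 ⊆ {z | 1 ≤ ‖z‖ ^ 2} := fun z hz => by
    rw [mem_ball_iff_norm'] at hz
    have hlower := norm_sub_norm_le (2 : ℂ) z
    rw [Complex.norm_ofNat] at hlower
    have hz₁ : 1 ≤ ‖z‖ := by linarith
    exact one_le_pow₀ hz₁
  refine lt_of_lt_of_le (pos_iff_ne_zero.2 fun h => ?_) (measure_mono hball)
  exact (Metric.measure_ball_pos volume (2 : ℂ) one_pos).ne'
    (volume_absolutelyContinuous_complexGaussian h)

theorem integral_exp_complexGaussian (t : ℂ) :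
    ∫ z, Complex.exp (((star t * z).re : ℝ) * Complex.I) ∂complexGaussian =
      Complex.exp (-((‖t‖ ^ 2 : ℝ) : ℂ) / 4) := by
  have hreal (s : ℝ) : ∫ x : ℝ, Complex.exp ((s * x : ℝ) * Complex.I) ∂gaussianReal 0 2⁻¹ =
      Complex.exp (-((s ^ 2 : ℝ) : ℂ) / 4) := by
    have h := charFun_gaussianReal (μ := 0) (v := 2⁻¹) s
    rw [charFun_apply_real] at h
    push_cast at h ⊢
    rw [h]
    congr 1
    ring
  have hsplit (p : ℝ × ℝ) : Complex.exp (((star t * (⟨p.1, p.2⟩ : ℂ)).re : ℝ) * Complex.I) =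
      Complex.exp ((t.re * p.1 : ℝ) * Complex.I) *
        Complex.exp ((t.im * p.2 : ℝ) * Complex.I) := by
    simp [← Complex.exp_add, add_mul]
  rw [complexGaussian, integral_map measurable_complex_mk.aemeasurable
    (Continuous.aestronglyMeasurable (by fun_prop))]
  simp_rw [hsplit]
  rw [integral_prod_mul (fun x : ℝ => Complex.exp ((t.re * x : ℝ) * Complex.I))
    (fun x : ℝ => Complex.exp ((t.im * x : ℝ) * Complex.I)), hreal, hreal, ← Complex.exp_add,
    ← Complex.normSq_eq_norm_sq, Complex.normSq_apply]
  congr 1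
  push_cast
  ring

end ComplexGaussian

section Hermitian

variable {ι κ : Type*} [Fintype ι] [Fintype κ]

theorem normSq_nonneg (v : ι → ℂ) : 0 ≤ normSq v :=
  Finset.sum_nonneg fun _ _ => sq_nonneg _

theorem normSq_eq_zero {v : ι → ℂ} : normSq v = 0 ↔ v = 0 := by
  rw [normSq, Finset.sum_eq_zero_iff_of_nonneg fun _ _ => sq_nonneg _]
  simp [funext_iff]

theorem normSq_pos {v : ι → ℂ} (h : v ≠ 0) : 0 < normSq v :=
  (normSq_nonneg v).lt_of_ne fun h0 => h (normSq_eq_zero.1 h0.symm)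

theorem norm_sq_le_normSq (v : ι → ℂ) (i : ι) : ‖v i‖ ^ 2 ≤ normSq v :=
  Finset.single_le_sum (f := fun i => ‖v i‖ ^ 2) (fun _ _ => sq_nonneg _) (Finset.mem_univ i)

@[fun_prop]
theorem measurable_normSq : Measurable (normSq : (ι → ℂ) → ℝ) := by
  unfold normSq
  fun_prop

theorem star_dotProduct_self (v : ι → ℂ) : star v ⬝ᵥ v = (normSq v : ℂ) := by
  rw [normSq, dotProduct]
  push_cast
  exact Finset.sum_congr rfl fun i _ => Complex.conj_mul' (v i)

theorem normSq_smul (c : ℂ) (v : ι → ℂ) : normSq (c • v) = ‖c‖ ^ 2 * normSq v := by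
  simp [normSq, mul_pow, Finset.mul_sum]

theorem norm_sq_ofReal_sqrt_normSq (v : ι → ℂ) : ‖((√(normSq v) : ℝ) : ℂ)‖ ^ 2 = normSq v := by
  rw [Complex.norm_real, Real.norm_eq_abs, sq_abs, Real.sq_sqrt (normSq_nonneg v)]

theorem normSq_inv_sqrt_smul {w : ι → ℂ} (hw : w ≠ 0) :
    normSq (((√(normSq w) : ℝ) : ℂ)⁻¹ • w) = 1 := by
  rw [normSq_smul, norm_inv, inv_pow, norm_sq_ofReal_sqrt_normSq,
    inv_mul_cancel₀ (normSq_pos hw).ne']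

theorem norm_sq_star_dotProduct_eq_mul {w : ι → ℂ} (hw : w ≠ 0) (z : ι → ℂ) :
    ‖star w ⬝ᵥ z‖ ^ 2 = normSq w * ‖star (((√(normSq w) : ℝ) : ℂ)⁻¹ • w) ⬝ᵥ z‖ ^ 2 := by
  rw [star_smul, smul_dotProduct, norm_smul, mul_pow, norm_star, norm_inv, inv_pow,
    norm_sq_ofReal_sqrt_normSq, mul_inv_cancel_left₀ (normSq_pos hw).ne']

theorem normSq_star (v : ι → ℂ) : normSq (star v) = normSq v := by
  simp [normSq]

theorem normSq_single [DecidableEq ι] (i : ι) (c : ℂ) : normSq (Pi.single i c) = ‖c‖ ^ 2 := by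
  rw [normSq, Finset.sum_eq_single i (fun j _ hj => by simp [hj]) (by simp), Pi.single_eq_same]

theorem norm_sq_star_dotProduct_le (v w : ι → ℂ) :
    ‖star v ⬝ᵥ w‖ ^ 2 ≤ normSq v * normSq w := by
  refine le_trans ?_ (Finset.sum_mul_sq_le_sq_mul_sq Finset.univ (fun i => ‖v i‖) (fun i => ‖w i‖))
  gcongr
  refine (norm_sum_le _ _).trans (Finset.sum_le_sum fun i _ => ?_)
  simp

theorem star_mulVec_dotProduct_mulVec [DecidableEq κ] {T : Matrix ι κ ℂ} (hT : Tᴴ * T = 1)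
    (x y : κ → ℂ) : star (T *ᵥ x) ⬝ᵥ (T *ᵥ y) = star x ⬝ᵥ y := by
  rw [Matrix.star_mulVec, ← Matrix.dotProduct_mulVec, Matrix.mulVec_mulVec, hT, Matrix.one_mulVec]

theorem normSq_mulVec [DecidableEq κ] {T : Matrix ι κ ℂ} (hT : Tᴴ * T = 1) (x : κ → ℂ) :
    normSq (T *ᵥ x) = normSq x := by
  have := star_mulVec_dotProduct_mulVec hT x x
  rw [star_dotProduct_self, star_dotProduct_self] at this
  exact_mod_cast this

theorem unitary_conjTranspose_mul [DecidableEq ι] (V : Matrix.unitaryGroup ι ℂ) :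
    (V : Matrix ι ι ℂ)ᴴ * (V : Matrix ι ι ℂ) = 1 := Matrix.mem_unitaryGroup_iff'.1 V.2

theorem exists_unitary_mulVec_single [DecidableEq ι] (v : ι → ι → ℂ) (s : Set ι)
    (hv : ∀ i ∈ s, ∀ j ∈ s, star (v i) ⬝ᵥ v j = if i = j then 1 else 0) :
    ∃ V : Matrix.unitaryGroup ι ℂ, ∀ i ∈ s, (V : Matrix ι ι ℂ) *ᵥ Pi.single i 1 = v i := by
  have hv' : Orthonormal ℂ (s.domRestrict fun i => WithLp.toLp 2 (v i)) := by
    rw [orthonormal_iff_ite]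
    intro i j
    have h : inner ℂ (WithLp.toLp 2 (v i)) (WithLp.toLp 2 (v j)) = star (v i) ⬝ᵥ v j := by
      rw [EuclideanSpace.inner_toLp_toLp, dotProduct_comm]
    refine h.trans ((hv i i.2 j j.2).trans ?_)
    simp only [Subtype.ext_iff]
  obtain ⟨b, hb⟩ := hv'.exists_orthonormalBasis_extension_of_card_eq (by simp)
  let W : Matrix ι ι ℂ := Matrix.of fun k l => b l k
  have hW : Wᴴ * W = 1 := by
    ext k l
    rw [Matrix.one_apply, ← orthonormal_iff_ite.1 b.orthonormal k l, PiLp.inner_apply]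
    simp [Matrix.mul_apply, W, mul_comm]
  refine ⟨⟨W, Matrix.mem_unitaryGroup_iff'.2 hW⟩, fun i hi => ?_⟩
  ext k
  simp [W, hb i hi]

theorem exists_unitary_smul_mulVec_single [DecidableEq ι] (v : ι → ι → ℂ)
    (hv : Pairwise fun i j => star (v i) ⬝ᵥ v j = 0) :
    ∃ V : Matrix.unitaryGroup ι ℂ, ∀ i,
      ((√(normSq (v i)) : ℝ) : ℂ) • ((V : Matrix ι ι ℂ) *ᵥ Pi.single i 1) = v i := by
  obtain ⟨V, hV⟩ := exists_unitary_mulVec_single (fun i => ((√(normSq (v i)) : ℝ) : ℂ)⁻¹ • v i)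
    {i | v i ≠ 0} fun i hi j _ => by
      rw [star_smul, smul_dotProduct, dotProduct_smul]
      split_ifs with hij
      · subst hij
        have hpos : 0 < √(normSq (v i)) := Real.sqrt_pos.2 (normSq_pos hi)
        rw [star_dotProduct_self, ← Real.mul_self_sqrt (normSq_nonneg (v i)), star_inv₀,
          RCLike.star_def, Complex.conj_ofReal, Real.sqrt_mul_self hpos.le, smul_eq_mul,
          smul_eq_mul, Complex.ofReal_mul]
        have : ((√(normSq (v i)) : ℝ) : ℂ) ≠ 0 := by exact_mod_cast hpos.ne'
        field_simp
      · rw [hv hij, smul_zero, smul_zero]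
  refine ⟨V, fun i => ?_⟩
  by_cases hi : v i = 0
  · rw [hi, normSq_eq_zero.2 rfl, Real.sqrt_zero, Complex.ofReal_zero, zero_smul]
  · have : ((√(normSq (v i)) : ℝ) : ℂ) ≠ 0 := by
      exact_mod_cast (Real.sqrt_pos.2 (normSq_pos hi)).ne'
    rw [hV i hi, smul_inv_smul₀ this]

theorem exists_unitary_smul_mulVec_pair [DecidableEq ι] {i j : ι} (hij : i ≠ j) {b u : ι → ℂ}
    (h : star b ⬝ᵥ u = 0) : ∃ V : Matrix.unitaryGroup ι ℂ,
      ((√(normSq b) : ℝ) : ℂ) • ((V : Matrix ι ι ℂ) *ᵥ Pi.single i 1) = b ∧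
      ((√(normSq u) : ℝ) : ℂ) • ((V : Matrix ι ι ℂ) *ᵥ Pi.single j 1) = u := by
  have h' : star u ⬝ᵥ b = 0 := by rw [Matrix.star_dotProduct, h, star_zero]
  obtain ⟨V, hV⟩ := exists_unitary_smul_mulVec_single
    (fun k => if k = i then b else if k = j then u else 0) fun k l hkl => by
      dsimp only
      split_ifs <;> simp_all
  exact ⟨V, by simpa using hV i, by simpa [hij.symm] using hV j⟩

theorem exists_normSq_eq_one_star_dotProduct_eq_zero [Nontrivial ι] (v : ι → ℂ) :
    ∃ f : ι → ℂ, normSq f = 1 ∧ star f ⬝ᵥ v = 0 := by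
  classical
  obtain ⟨i, j, hij⟩ := exists_pair_ne ι
  obtain ⟨V, hV, -⟩ := exists_unitary_smul_mulVec_pair hij
    (show star v ⬝ᵥ (0 : ι → ℂ) = 0 from dotProduct_zero _)
  refine ⟨(V : Matrix ι ι ℂ) *ᵥ Pi.single j 1, ?_, ?_⟩
  · rw [normSq_mulVec (unitary_conjTranspose_mul V), normSq_single, norm_one, one_pow]
  · conv_lhs => rw [← hV]
    rw [dotProduct_smul, star_mulVec_dotProduct_mulVec (unitary_conjTranspose_mul V)]
    simp [hij]

end Hermitian

section GaussianMatrix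

instance borelSpace_matrix {ι κ : Type*} [Countable ι] [Countable κ] : BorelSpace (Matrix ι κ ℂ) :=
  inferInstanceAs (BorelSpace (ι → κ → ℂ))

/-- The law of a matrix with i.i.d. `CN(0,1)` entries; `rayleigh` for arbitrary index types. -/
noncomputable def gaussMat (ι κ : Type*) [Fintype ι] [Fintype κ] : Measure (Matrix ι κ ℂ) :=
  Measure.pi fun _ : ι => Measure.pi fun _ : κ => complexGaussian

/-- The law of a vector with i.i.d. `CN(0,1)` entries. -/
noncomputable def gaussVec (ι : Type*) [Fintype ι] : Measure (ι → ℂ) :=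
  Measure.pi fun _ : ι => complexGaussian

variable {ι κ : Type*} [Fintype ι] [Fintype κ]

instance isProbabilityMeasure_gaussMat : IsProbabilityMeasure (gaussMat ι κ) :=
  inferInstanceAs (IsProbabilityMeasure (Measure.pi fun _ : ι => Measure.pi fun _ : κ => _))

instance isProbabilityMeasure_gaussVec : IsProbabilityMeasure (gaussVec ι) :=
  inferInstanceAs (IsProbabilityMeasure (Measure.pi fun _ : ι => _))

theorem re_trace_conjTranspose_mul (T K : Matrix ι κ ℂ) :
    ((Tᴴ * K).trace).re = ∑ i, ∑ j, (star (T i j) * K i j).re := by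
  simp only [Matrix.trace, Matrix.diag, Matrix.mul_apply, Matrix.conjTranspose_apply,
    Complex.re_sum]
  exact Finset.sum_comm

theorem exists_eq_re_trace_conjTranspose_mul
    (L : StrongDual ℝ (ι → κ → ℂ)) :
    ∃ T : Matrix ι κ ℂ, ∀ K : Matrix ι κ ℂ, L K = ((Tᴴ * K).trace).re := by
  classical
  refine ⟨Matrix.of fun i j => ⟨L (Pi.single i (Pi.single j 1)),
    L (Pi.single i (Pi.single j Complex.I))⟩, fun K => ?_⟩
  have hentry (i : ι) (j : κ) (z : ℂ) : L (Pi.single i (Pi.single j z)) =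
      z.re * L (Pi.single i (Pi.single j 1)) + z.im * L (Pi.single i (Pi.single j Complex.I)) := by
    rw [← smul_eq_mul, ← smul_eq_mul, ← map_smul, ← map_smul, ← map_add, ← Pi.single_smul,
      ← Pi.single_smul, ← Pi.single_smul, ← Pi.single_smul, ← Pi.single_add, ← Pi.single_add]
    congr 3
    simp
  have hrow (i : ι) : L (Pi.single i (K i)) = ∑ j, L (Pi.single i (Pi.single j (K i j))) := by
    have h := map_sum (L ∘L ContinuousLinearMap.single ℝ _ i) (fun j => Pi.single j (K i j))
      Finset.univ
    rwa [Finset.univ_sum_single] at h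
  have hmat : L K = ∑ i, L (Pi.single i (K i)) := by
    refine Eq.trans ?_ (map_sum L (fun i => Pi.single i (K i)) Finset.univ)
    exact congrArg L (Finset.univ_sum_single (K : ι → κ → ℂ)).symm
  rw [hmat, re_trace_conjTranspose_mul]
  refine Finset.sum_congr rfl fun i _ => (hrow i).trans (Finset.sum_congr rfl fun j _ => ?_)
  rw [hentry, Matrix.of_apply, RCLike.star_def, Complex.mul_re, Complex.conj_re, Complex.conj_im]
  ring

theorem integral_exp_gaussMat (T : Matrix ι κ ℂ) :
    ∫ K, Complex.exp ((((Tᴴ * K).trace).re : ℝ) * Complex.I) ∂gaussMat ι κ =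
      Complex.exp (-((((Tᴴ * T).trace).re : ℝ) : ℂ) / 4) := by
  have hprod (K : Matrix ι κ ℂ) : Complex.exp ((((Tᴴ * K).trace).re : ℝ) * Complex.I) =
      ∏ i, ∏ j, Complex.exp (((star (T i j) * K i j).re : ℝ) * Complex.I) := by
    simp_rw [re_trace_conjTranspose_mul, Complex.ofReal_sum, Finset.sum_mul, Complex.exp_sum]
  have hrow (i : ι) := integral_fintype_prod_eq_prod (μ := fun _ : κ => complexGaussian)
    (fun j (z : ℂ) => Complex.exp (((star (T i j) * z).re : ℝ) * Complex.I))
  have hmat := integral_fintype_prod_eq_prod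
    (μ := fun _ : ι => Measure.pi fun _ : κ => complexGaussian)
    (fun i (K : κ → ℂ) => ∏ j, Complex.exp (((star (T i j) * K j).re : ℝ) * Complex.I))
  have hnorm (t : ℂ) : (star t * t).re = ‖t‖ ^ 2 := by
    rw [RCLike.star_def, Complex.conj_mul', ← Complex.ofReal_pow, Complex.ofReal_re]
  simp_rw [hrow, integral_exp_complexGaussian] at hmat
  simp_rw [hprod, re_trace_conjTranspose_mul, hnorm]
  refine hmat.trans ?_
  simp_rw [← Complex.exp_sum, Complex.ofReal_sum, ← Finset.sum_neg_distrib, Finset.sum_div]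

theorem measurePreserving_unitary_gaussMat [DecidableEq ι]
    (V : Matrix.unitaryGroup ι ℂ) :
    MeasurePreserving (fun K : Matrix ι κ ℂ => (V : Matrix ι ι ℂ) * K)
      (gaussMat ι κ) (gaussMat ι κ) := by
  have hm : Measurable (fun K : Matrix ι κ ℂ => (V : Matrix ι ι ℂ) * K) :=
    (by fun_prop : Continuous (fun K : Matrix ι κ ℂ => (V : Matrix ι ι ℂ) * K)).measurable
  refine ⟨hm, ?_⟩
  -- Characteristic functions need the normed space `ι → κ → ℂ`; `Matrix` carries no global norm.
  let P : Measure (ι → κ → ℂ) := gaussMat ι κ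
  let f : (ι → κ → ℂ) → ι → κ → ℂ := fun K => (V : Matrix ι ι ℂ) * Matrix.of K
  have hf : Measurable f := hm
  have : IsProbabilityMeasure P := isProbabilityMeasure_gaussMat
  have := Measure.isProbabilityMeasure_map (μ := P) hf.aemeasurable
  suffices P.map f = P from this
  refine Measure.ext_of_charFunDual (funext fun L => ?_)
  obtain ⟨T, hT⟩ := exists_eq_re_trace_conjTranspose_mul L
  have hV : (V : Matrix ι ι ℂ) * (V : Matrix ι ι ℂ)ᴴ = 1 := Matrix.mem_unitaryGroup_iff.1 V.2
  have hf' (K : ι → κ → ℂ) : L (f K) = ((((V : Matrix ι ι ℂ)ᴴ * T)ᴴ * Matrix.of K).trace).re := by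
    rw [Matrix.conjTranspose_mul, Matrix.conjTranspose_conjTranspose, Matrix.mul_assoc]
    exact hT _
  have htrace : ((V : Matrix ι ι ℂ)ᴴ * T)ᴴ * ((V : Matrix ι ι ℂ)ᴴ * T) = Tᴴ * T := by
    rw [Matrix.conjTranspose_mul, Matrix.conjTranspose_conjTranspose, Matrix.mul_assoc,
      ← Matrix.mul_assoc (V : Matrix ι ι ℂ), hV, Matrix.one_mul]
  rw [charFunDual_apply, charFunDual_apply, integral_map hf.aemeasurable (by fun_prop)]
  calc ∫ K, Complex.exp ((L (f K) : ℝ) * Complex.I) ∂P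
      = Complex.exp (-((((Tᴴ * T).trace).re : ℝ) : ℂ) / 4) := by
        simp_rw [hf']
        exact (integral_exp_gaussMat _).trans (by rw [htrace])
    _ = ∫ K, Complex.exp ((L K : ℝ) * Complex.I) ∂P := by
        rw [← integral_exp_gaussMat]
        exact integral_congr_ae (ae_of_all _ fun K =>
          congrArg (fun r : ℝ => Complex.exp (r * Complex.I)) (hT K).symm)

theorem measurePreserving_col_gaussMat (j : κ) :
    MeasurePreserving (fun (K : Matrix ι κ ℂ) i => K i j) (gaussMat ι κ) (gaussVec ι) :=
  measurePreserving_pi (fun _ : ι => Measure.pi fun _ : κ => complexGaussian) _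
    fun _ => measurePreserving_eval (fun _ : κ => complexGaussian) j

theorem measurePreserving_unitary_gaussVec [DecidableEq ι] (V : Matrix.unitaryGroup ι ℂ) :
    MeasurePreserving (fun z : ι → ℂ => (V : Matrix ι ι ℂ) *ᵥ z) (gaussVec ι) (gaussVec ι) :=
  MeasurePreserving.of_semiconj (measurePreserving_col_gaussMat (κ := Unit) ())
    (measurePreserving_unitary_gaussMat V) (fun _ => rfl)
    (by fun_prop : Continuous fun z : ι → ℂ => (V : Matrix ι ι ℂ) *ᵥ z).measurable

theorem measurable_star_dotProduct (e : ι → ℂ) : Measurable fun z : ι → ℂ => star e ⬝ᵥ z := by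
  unfold dotProduct
  fun_prop

theorem lintegral_rpow_neg_const_mul {α : Type*} [MeasurableSpace α] (μ : Measure α) {c : ℝ}
    (hc : 0 ≤ c) {f : α → ℝ} (hf : Measurable f) (θ : ℝ) :
    ∫⁻ a, ENNReal.ofReal (c * f a) ^ (-θ) ∂μ =
      ENNReal.ofReal c ^ (-θ) * ∫⁻ a, ENNReal.ofReal (f a) ^ (-θ) ∂μ := by
  rw [← lintegral_const_mul _ (by fun_prop)]
  exact lintegral_congr fun a => by
    rw [ENNReal.ofReal_mul hc,
      ENNReal.mul_rpow_of_ne_top ENNReal.ofReal_ne_top ENNReal.ofReal_ne_top]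

theorem star_mulVec_single_dotProduct [DecidableEq ι] (V : Matrix.unitaryGroup ι ℂ) (i : ι)
    (z : ι → ℂ) :
    star ((V : Matrix ι ι ℂ) *ᵥ Pi.single i 1) ⬝ᵥ z =
      (((V⁻¹ : Matrix.unitaryGroup ι ℂ) : Matrix ι ι ℂ) *ᵥ z) i := by
  rw [Matrix.star_mulVec, ← Matrix.dotProduct_mulVec, Pi.star_single, star_one,
    single_one_dotProduct]
  rfl

theorem measurePreserving_star_dotProduct_gaussVec {e : ι → ℂ} (he : normSq e = 1) :
    MeasurePreserving (fun z : ι → ℂ => star e ⬝ᵥ z) (gaussVec ι) complexGaussian := by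
  classical
  obtain ⟨i⟩ : Nonempty ι := by
    by_contra h
    rw [not_nonempty_iff] at h
    simp [normSq] at he
  obtain ⟨V, hV⟩ := exists_unitary_mulVec_single (fun _ => e) {i} (by
    rintro k rfl l rfl
    simp [star_dotProduct_self, he])
  simp_rw [← hV i rfl, star_mulVec_single_dotProduct]
  exact (measurePreserving_eval (fun _ : ι => complexGaussian) i).comp
    (measurePreserving_unitary_gaussVec V⁻¹)

theorem lintegral_rpow_neg_star_dotProduct_gaussVec {w : ι → ℂ} (hw : w ≠ 0) (θ : ℝ) :
    ∫⁻ z, ENNReal.ofReal (‖star w ⬝ᵥ z‖ ^ 2) ^ (-θ) ∂gaussVec ι =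
      ENNReal.ofReal (normSq w) ^ (-θ) *
        ∫⁻ z, ENNReal.ofReal (‖z‖ ^ 2) ^ (-θ) ∂complexGaussian := by
  simp_rw [norm_sq_star_dotProduct_eq_mul hw]
  rw [lintegral_rpow_neg_const_mul _ (normSq_nonneg w)
      ((measurable_star_dotProduct _).norm.pow_const 2),
    ← (measurePreserving_star_dotProduct_gaussVec (normSq_inv_sqrt_smul hw)).lintegral_comp
      (f := fun z => ENNReal.ofReal (‖z‖ ^ 2) ^ (-θ)) (by fun_prop)]

theorem measurePreserving_eval_pair_gaussVec {i j : ι} (hij : i ≠ j) :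
    MeasurePreserving (fun z : ι → ℂ => (z i, z j)) (gaussVec ι)
      (complexGaussian.prod complexGaussian) := by
  have hi := measurePreserving_eval (fun _ : ι => complexGaussian) i
  have hj := measurePreserving_eval (fun _ : ι => complexGaussian) j
  have hind : IndepFun (fun z : ι → ℂ => z i) (fun z => z j) (gaussVec ι) :=
    (iIndepFun_pi (μ := fun _ : ι => complexGaussian) (X := fun _ z => z)
      fun _ => aemeasurable_id).indepFun hij
  refine ⟨by fun_prop, ?_⟩
  rw [(indepFun_iff_map_prod_eq_prod_map_map hi.measurable.aemeasurable
    hj.measurable.aemeasurable).1 hind]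
  exact congrArg₂ Measure.prod hi.map_eq hj.map_eq

theorem measurePreserving_star_dotProduct_pair_gaussVec {i j : ι} (hij : i ≠ j) {e f : ι → ℂ}
    (he : normSq e = 1) (hf : normSq f = 1) (hef : star e ⬝ᵥ f = 0) :
    MeasurePreserving (fun z : ι → ℂ => (star e ⬝ᵥ z, star f ⬝ᵥ z)) (gaussVec ι)
      (complexGaussian.prod complexGaussian) := by
  classical
  obtain ⟨V, hVi, hVj⟩ := exists_unitary_smul_mulVec_pair hij hef
  rw [he, Real.sqrt_one, Complex.ofReal_one, one_smul] at hVi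
  rw [hf, Real.sqrt_one, Complex.ofReal_one, one_smul] at hVj
  simp_rw [← hVi, ← hVj, star_mulVec_single_dotProduct]
  exact (measurePreserving_eval_pair_gaussVec hij).comp (measurePreserving_unitary_gaussVec V⁻¹)

end GaussianMatrix

section OrthonormalPair

variable {ι : Type*} [Fintype ι] [DecidableEq ι]

instance compactSpace_unitaryGroup : CompactSpace (Matrix.unitaryGroup ι ℂ) := by
  have hbox : IsCompact {A : ι → ι → ℂ | ∀ i j, ‖A i j‖ ≤ 1} := by
    convert isCompact_univ_pi fun _ : ι => isCompact_univ_pi fun _ : ι =>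
      isCompact_closedBall (0 : ℂ) 1
    ext A
    simp only [Set.mem_ofPred_eq, Set.mem_univ_pi, mem_closedBall_zero_iff]
  have hbox' : IsCompact {A : Matrix ι ι ℂ | ∀ i j, ‖A i j‖ ≤ 1} := hbox
  exact isCompact_iff_compactSpace.1 (hbox'.of_isClosed_subset isClosed_unitary
    fun A hA i j => entry_norm_bound_of_unitary hA i j)

/-- Haar probability measure on the unitary group, inverted so that its invariance under right
translations is found by instance search. -/
noncomputable def unitaryHaar (ι : Type*) [Fintype ι] [DecidableEq ι] :
    Measure (Matrix.unitaryGroup ι ℂ) :=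
  (Measure.haarMeasure (⊤ : TopologicalSpace.PositiveCompacts (Matrix.unitaryGroup ι ℂ))).inv

instance isMulRightInvariant_unitaryHaar : (unitaryHaar ι).IsMulRightInvariant :=
  inferInstanceAs (Measure.inv _).IsMulRightInvariant

instance isProbabilityMeasure_unitaryHaar : IsProbabilityMeasure (unitaryHaar ι) := by
  constructor
  rw [unitaryHaar, Measure.inv_apply, Set.inv_univ]
  exact Measure.haarMeasure_self

theorem measurable_unitary_mulVec_pair :
    Measurable fun p : Matrix.unitaryGroup ι ℂ × ((ι → ℂ) × (ι → ℂ)) =>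
      ((p.1 : Matrix ι ι ℂ) *ᵥ p.2.1, (p.1 : Matrix ι ι ℂ) *ᵥ p.2.2) := by
  have hA : Continuous fun p : Matrix.unitaryGroup ι ℂ × ((ι → ℂ) × (ι → ℂ)) =>
      (p.1 : Matrix ι ι ℂ) := by fun_prop
  exact ((hA.matrix_mulVec (by fun_prop)).prodMk (hA.matrix_mulVec (by fun_prop))).measurable

/-- The uniform law on orthonormal pairs of vectors, as the law of the columns `i` and `j` of a
Haar distributed unitary matrix. -/
noncomputable def orthonormalPairLaw (i j : ι) : Measure ((ι → ℂ) × (ι → ℂ)) :=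
  (unitaryHaar ι).map fun V : Matrix.unitaryGroup ι ℂ => ((V : Matrix ι ι ℂ) *ᵥ Pi.single i 1,
    (V : Matrix ι ι ℂ) *ᵥ Pi.single j 1)

/-- A unitarily invariant law on pairs of orthogonal vectors. -/
structure IsInvariantPair (ν : Measure ((ι → ℂ) × (ι → ℂ))) : Prop where
  invariant : ∀ V : Matrix.unitaryGroup ι ℂ, MeasurePreserving (fun q : (ι → ℂ) × (ι → ℂ) =>
    ((V : Matrix ι ι ℂ) *ᵥ q.1, (V : Matrix ι ι ℂ) *ᵥ q.2)) ν ν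
  orthogonal : ∀ᵐ q ∂ν, star q.1 ⬝ᵥ q.2 = 0

theorem measurable_unitary_mulVec_single_pair (i j : ι) :
    Measurable fun V : Matrix.unitaryGroup ι ℂ => ((V : Matrix ι ι ℂ) *ᵥ Pi.single i (1 : ℂ),
      (V : Matrix ι ι ℂ) *ᵥ Pi.single j (1 : ℂ)) := by
  have h (q : (ι → ℂ) × (ι → ℂ)) := measurable_unitary_mulVec_pair.comp
    (measurable_id.prodMk (measurable_const (a := q)) : Measurable fun V => (V, q))
  exact h (Pi.single i 1, Pi.single j 1)

theorem lintegral_unitary_mulVec_pair {i j : ι} (hij : i ≠ j) {b u : ι → ℂ}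
    (hbu : star b ⬝ᵥ u = 0) {F : (ι → ℂ) × (ι → ℂ) → ℝ≥0∞} (hF : Measurable F) :
    ∫⁻ V : Matrix.unitaryGroup ι ℂ, F ((V : Matrix ι ι ℂ) *ᵥ b, (V : Matrix ι ι ℂ) *ᵥ u)
      ∂unitaryHaar ι =
    ∫⁻ p, F (((√(normSq b) : ℝ) : ℂ) • p.1, ((√(normSq u) : ℝ) : ℂ) • p.2)
      ∂orthonormalPairLaw i j := by
  obtain ⟨W, hWb, hWu⟩ := exists_unitary_smul_mulVec_pair hij hbu
  rw [orthonormalPairLaw,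
    lintegral_map (by fun_prop) (measurable_unitary_mulVec_single_pair i j)]
  refine Eq.trans (lintegral_congr fun V => ?_) (lintegral_mul_right_eq_self _ W)
  conv_lhs => rw [← hWb, ← hWu]
  simp_rw [Matrix.mulVec_smul, Matrix.mulVec_mulVec]
  rfl

theorem IsInvariantPair.lintegral_eq {i j : ι} (hij : i ≠ j)
    {ν : Measure ((ι → ℂ) × (ι → ℂ))} [SFinite ν] (hν : IsInvariantPair ν)
    {F : (ι → ℂ) × (ι → ℂ) → ℝ≥0∞} (hF : Measurable F) :
    ∫⁻ q, F q ∂ν = ∫⁻ q, ∫⁻ p, F (((√(normSq q.1) : ℝ) : ℂ) • p.1,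
      ((√(normSq q.2) : ℝ) : ℂ) • p.2) ∂orthonormalPairLaw i j ∂ν :=
  calc ∫⁻ q, F q ∂ν
      = ∫⁻ _V, ∫⁻ q, F q ∂ν ∂unitaryHaar ι := by rw [lintegral_const, measure_univ, mul_one]
    _ = ∫⁻ V : Matrix.unitaryGroup ι ℂ, ∫⁻ q, F ((V : Matrix ι ι ℂ) *ᵥ q.1,
        (V : Matrix ι ι ℂ) *ᵥ q.2) ∂ν ∂unitaryHaar ι :=
        lintegral_congr fun V => ((hν.invariant V).lintegral_comp hF).symm
    _ = ∫⁻ q, ∫⁻ V : Matrix.unitaryGroup ι ℂ, F ((V : Matrix ι ι ℂ) *ᵥ q.1,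
        (V : Matrix ι ι ℂ) *ᵥ q.2) ∂unitaryHaar ι ∂ν :=
        lintegral_lintegral_swap (hF.comp measurable_unitary_mulVec_pair).aemeasurable
    _ = _ := lintegral_congr_ae <| hν.orthogonal.mono fun _ hq =>
        lintegral_unitary_mulVec_pair hij hq hF

theorem IsInvariantPair.measure_eq_lintegral {i j : ι} (hij : i ≠ j)
    {ν : Measure ((ι → ℂ) × (ι → ℂ))} [SFinite ν] (hν : IsInvariantPair ν)
    {E : Set ((ι → ℂ) × (ι → ℂ))} (hE : MeasurableSet E) :
    ν E = ∫⁻ q, orthonormalPairLaw i j {p | (((√(normSq q.1) : ℝ) : ℂ) • p.1,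
      ((√(normSq q.2) : ℝ) : ℂ) • p.2) ∈ E} ∂ν := by
  rw [← lintegral_indicator_one hE, hν.lintegral_eq hij (measurable_one.indicator hE)]
  refine lintegral_congr fun q => ?_
  exact lintegral_indicator_one ((by fun_prop : Measurable fun p : (ι → ℂ) × (ι → ℂ) =>
    (((√(normSq q.1) : ℝ) : ℂ) • p.1, ((√(normSq q.2) : ℝ) : ℂ) • p.2)) hE)

theorem ae_normSq_fst_orthonormalPairLaw (i j : ι) :
    ∀ᵐ p ∂orthonormalPairLaw i j, normSq p.1 = 1 := by
  rw [orthonormalPairLaw, ae_map_iff (measurable_unitary_mulVec_single_pair i j).aemeasurable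
    (measurableSet_eq_fun (by fun_prop) measurable_const)]
  exact ae_of_all _ fun V => by
    rw [normSq_mulVec (unitary_conjTranspose_mul V), normSq_single, norm_one, one_pow]

end OrthonormalPair

section Rejection

variable {ι : Type*} [Fintype ι]

/-- The component of `z` orthogonal to `u`; it is `z` when `u = 0`, because division by zero
gives zero. -/
noncomputable def rejection (u z : ι → ℂ) : ι → ℂ := z - ((star u ⬝ᵥ z) / (normSq u : ℂ)) • u

theorem star_rejection_dotProduct (u z w : ι → ℂ) :
    star (rejection u z) ⬝ᵥ w = star z ⬝ᵥ rejection u w := by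
  have hreal : star (normSq u : ℂ) = normSq u := Complex.conj_ofReal _
  simp only [rejection, star_sub, star_smul, sub_dotProduct, dotProduct_sub, smul_dotProduct,
    dotProduct_smul, smul_eq_mul, star_div₀, hreal, ← Matrix.star_dotProduct]
  ring

theorem rejection_self (u : ι → ℂ) : rejection u u = 0 := by
  rw [rejection, star_dotProduct_self]
  by_cases hu : u = 0
  · rw [hu, smul_zero, sub_zero]
  · have : (normSq u : ℂ) ≠ 0 := by exact_mod_cast (normSq_pos hu).ne'
    rw [div_self this, one_smul, sub_self]

theorem star_rejection_dotProduct_self (u z : ι → ℂ) : star (rejection u z) ⬝ᵥ u = 0 := by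
  rw [star_rejection_dotProduct, rejection_self, dotProduct_zero]

theorem rejection_of_orthogonal {u z : ι → ℂ} (h : star u ⬝ᵥ z = 0) : rejection u z = z := by
  rw [rejection, h, zero_div, zero_smul, sub_zero]

theorem normSq_rejection (u z : ι → ℂ) :
    normSq (rejection u z) = normSq z - ‖star u ⬝ᵥ z‖ ^ 2 / normSq u := by
  have hconj : star z ⬝ᵥ u = star (star u ⬝ᵥ z) := by rw [Matrix.star_dotProduct]
  have hidem : rejection u (rejection u z) = rejection u z := rejection_of_orthogonal <| by
    rw [Matrix.star_dotProduct, star_rejection_dotProduct_self, star_zero]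
  have h : (normSq (rejection u z) : ℂ) = normSq z - ‖star u ⬝ᵥ z‖ ^ 2 / normSq u := by
    rw [← star_dotProduct_self, star_rejection_dotProduct, hidem, rejection, dotProduct_sub,
      star_dotProduct_self, dotProduct_smul, smul_eq_mul, hconj, ← Complex.mul_conj']
    simp only [starRingEnd_apply]
    ring
  exact_mod_cast h

theorem rejection_mulVec [DecidableEq ι] (V : Matrix.unitaryGroup ι ℂ) (u z : ι → ℂ) :
    rejection ((V : Matrix ι ι ℂ) *ᵥ u) ((V : Matrix ι ι ℂ) *ᵥ z) =
      (V : Matrix ι ι ℂ) *ᵥ rejection u z := by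
  rw [rejection, rejection, Matrix.mulVec_sub, Matrix.mulVec_smul,
    star_mulVec_dotProduct_mulVec (unitary_conjTranspose_mul V),
    normSq_mulVec (unitary_conjTranspose_mul V)]

theorem measurable_rejection : Measurable fun q : (ι → ℂ) × (ι → ℂ) => rejection q.1 q.2 := by
  unfold rejection dotProduct normSq
  simp only [Pi.star_apply]
  fun_prop

end Rejection

section TopDot

variable {τ β : Type*}

theorem normSq_smul_comp_inr [Fintype β] (c : ℂ) (u : τ ⊕ β → ℂ) :
    normSq ((c • u) ∘ Sum.inr) = ‖c‖ ^ 2 * normSq (u ∘ Sum.inr) := by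
  rw [Pi.smul_comp, normSq_smul]

variable [Fintype τ]

/-- The Hermitian product of the restrictions of two vectors to the first block of indices: the
product of a combined channel with the detection vector of the near user. -/
noncomputable def topDot (b u : τ ⊕ β → ℂ) : ℂ := star (b ∘ Sum.inl) ⬝ᵥ (u ∘ Sum.inl)

theorem measurable_topDot :
    Measurable fun q : (τ ⊕ β → ℂ) × (τ ⊕ β → ℂ) => topDot q.1 q.2 := by
  unfold topDot dotProduct
  simp only [Pi.star_apply, Function.comp_apply]
  fun_prop

theorem norm_sq_topDot_smul (s t : ℂ) (b u : τ ⊕ β → ℂ) :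
    ‖topDot (s • b) (t • u)‖ ^ 2 = ‖s‖ ^ 2 * ‖t‖ ^ 2 * ‖topDot b u‖ ^ 2 := by
  change ‖star (s • (b ∘ Sum.inl)) ⬝ᵥ t • (u ∘ Sum.inl)‖ ^ 2 = _
  rw [star_smul, smul_dotProduct, dotProduct_smul, norm_smul, norm_smul, norm_star, topDot]
  ring

variable [Fintype β]

/-- The vector orthogonal to `u` that represents `b ↦ topDot b u` on the orthogonal complement
of `u`. -/
noncomputable def topRejection (u : τ ⊕ β → ℂ) : τ ⊕ β → ℂ :=
  rejection u (Sum.elim (u ∘ Sum.inl) 0)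

theorem normSq_comp_inl_add_normSq_comp_inr (u : τ ⊕ β → ℂ) :
    normSq (u ∘ Sum.inl) + normSq (u ∘ Sum.inr) = normSq u :=
  (Fintype.sum_sum_type fun i => ‖u i‖ ^ 2).symm

theorem star_dotProduct_sumElim_zero (b u : τ ⊕ β → ℂ) :
    star b ⬝ᵥ Sum.elim (u ∘ Sum.inl) 0 = topDot b u := by
  simp [topDot, dotProduct]

theorem normSq_sumElim_zero (a : τ → ℂ) : normSq (Sum.elim a (0 : β → ℂ)) = normSq a := by
  simp [normSq]

theorem norm_topDot_rejection (u z : τ ⊕ β → ℂ) :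
    ‖topDot (rejection u z) u‖ = ‖star (topRejection u) ⬝ᵥ z‖ := by
  rw [← star_dotProduct_sumElim_zero, star_rejection_dotProduct, topRejection, ← norm_star,
    ← Matrix.star_dotProduct]

theorem normSq_topRejection (u : τ ⊕ β → ℂ) :
    normSq (topRejection u) = normSq (u ∘ Sum.inl) * normSq (u ∘ Sum.inr) / normSq u := by
  have hself : topDot u u = (normSq (u ∘ Sum.inl) : ℂ) := star_dotProduct_self _
  rw [topRejection, normSq_rejection, star_dotProduct_sumElim_zero, hself, normSq_sumElim_zero,
    Complex.norm_real, Real.norm_eq_abs, sq_abs, ← normSq_comp_inl_add_normSq_comp_inr u]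
  rcases (add_nonneg (normSq_nonneg (u ∘ Sum.inl)) (normSq_nonneg (u ∘ Sum.inr))).eq_or_lt
    with h | h
  · have hl : normSq (u ∘ Sum.inl) = 0 := by
      linarith [normSq_nonneg (u ∘ Sum.inl), normSq_nonneg (u ∘ Sum.inr)]
    simp [hl]
  · field_simp
    ring

theorem normSq_topRejection_le_normSq_comp_inr (u : τ ⊕ β → ℂ) :
    normSq (topRejection u) ≤ normSq (u ∘ Sum.inr) := by
  rw [normSq_topRejection, mul_comm, mul_div_assoc]
  refine mul_le_of_le_one_right (normSq_nonneg _) (div_le_one_of_le₀ ?_ (normSq_nonneg _))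
  linarith [normSq_comp_inl_add_normSq_comp_inr u, normSq_nonneg (u ∘ Sum.inr)]

theorem topRejection_ne_zero {u : τ ⊕ β → ℂ} {t : τ} {b : β} (ht : u (Sum.inl t) ≠ 0)
    (hb : u (Sum.inr b) ≠ 0) : topRejection u ≠ 0 := by
  have htop : u ∘ Sum.inl ≠ 0 := fun h => ht (congrFun h t)
  have hbot : u ∘ Sum.inr ≠ 0 := fun h => hb (congrFun h b)
  rw [Ne, ← normSq_eq_zero, normSq_topRejection, ← normSq_comp_inl_add_normSq_comp_inr]
  have := normSq_pos htop
  have := normSq_pos hbot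
  positivity

theorem normSq_topRejection_le_normSq_comp_inl (u : τ ⊕ β → ℂ) :
    normSq (topRejection u) ≤ normSq (u ∘ Sum.inl) := by
  rw [normSq_topRejection, mul_div_assoc]
  refine mul_le_of_le_one_right (normSq_nonneg _) (div_le_one_of_le₀ ?_ (normSq_nonneg _))
  linarith [normSq_comp_inl_add_normSq_comp_inr u, normSq_nonneg (u ∘ Sum.inl)]

theorem star_dotProduct_topRejection_self (u : τ ⊕ β → ℂ) : star u ⬝ᵥ topRejection u = 0 := by
  rw [topRejection, ← star_rejection_dotProduct, rejection_self, star_zero, zero_dotProduct]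

/-- The law of `(z - proj_u z, u)` for independent standard Gaussian vectors `u` and `z`: an
explicit unitarily invariant law on orthogonal pairs. -/
noncomputable def gaussPair (ι : Type*) [Fintype ι] : Measure ((ι → ℂ) × (ι → ℂ)) :=
  ((gaussVec ι).prod (gaussVec ι)).map fun q => (rejection q.1 q.2, q.1)

theorem measurable_rejection_pair {ι : Type*} [Fintype ι] :
    Measurable fun q : (ι → ℂ) × (ι → ℂ) => (rejection q.1 q.2, q.1) :=
  measurable_rejection.prodMk measurable_fst

instance isProbabilityMeasure_gaussPair {ι : Type*} [Fintype ι] :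
    IsProbabilityMeasure (gaussPair ι) :=
  Measure.isProbabilityMeasure_map measurable_rejection_pair.aemeasurable

theorem isInvariantPair_gaussPair {ι : Type*} [Fintype ι] [DecidableEq ι] :
    IsInvariantPair (gaussPair ι) where
  invariant V := MeasurePreserving.of_semiconj (measurable_rejection_pair.measurePreserving _)
    ((measurePreserving_unitary_gaussVec V).prod (measurePreserving_unitary_gaussVec V))
    (fun q => Prod.ext (rejection_mulVec V q.1 q.2) rfl)
    (measurable_unitary_mulVec_pair.comp measurable_prodMk_left)
  orthogonal := by
    have hmeas : Measurable fun q : (ι → ℂ) × (ι → ℂ) => star q.1 ⬝ᵥ q.2 := by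
      unfold dotProduct
      simp only [Pi.star_apply]
      fun_prop
    rw [gaussPair, ae_map_iff measurable_rejection_pair.aemeasurable
      (measurableSet_eq_fun hmeas measurable_const)]
    exact ae_of_all _ fun q => star_rejection_dotProduct_self q.1 q.2

end TopDot

section PairMoment

variable {ι τ β : Type*} [Fintype ι] {θ : ℝ}

theorem ofReal_rpow_neg_anti {x y : ℝ} (hθ : 0 ≤ θ) (h : x ≤ y) :
    ENNReal.ofReal y ^ (-θ) ≤ ENNReal.ofReal x ^ (-θ) := by
  rw [ENNReal.rpow_neg, ENNReal.rpow_neg]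
  exact ENNReal.inv_le_inv.2 (ENNReal.rpow_le_rpow (ENNReal.ofReal_le_ofReal h) hθ)

theorem ofReal_mul_div_add_rpow_neg_le {x y : ℝ} (hx : 0 < x) (hy : 0 < y) (hθ : 0 ≤ θ)
    (hθ₁ : θ ≤ 1) : ENNReal.ofReal (x * y / (x + y)) ^ (-θ) ≤
      ENNReal.ofReal x ^ (-θ) + ENNReal.ofReal y ^ (-θ) := by
  have hinv : (x * y / (x + y))⁻¹ = x⁻¹ + y⁻¹ := by
    field_simp
    ring
  simp only [ENNReal.rpow_neg, ← ENNReal.inv_rpow]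
  rw [← ENNReal.ofReal_inv_of_pos (by positivity), ← ENNReal.ofReal_inv_of_pos hx,
    ← ENNReal.ofReal_inv_of_pos hy, hinv, ENNReal.ofReal_add (by positivity) (by positivity)]
  exact ENNReal.rpow_add_le_add_rpow _ _ hθ hθ₁

theorem lintegral_rpow_neg_eval_gaussVec_lt_top (i : ι) (hθ₁ : θ < 1) :
    ∫⁻ u, ENNReal.ofReal (‖u i‖ ^ 2) ^ (-θ) ∂gaussVec ι < ∞ := by
  have h : MeasurePreserving (fun u : ι → ℂ => u i) (gaussVec ι) complexGaussian :=
    measurePreserving_eval (fun _ : ι => complexGaussian) i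
  rw [h.lintegral_comp (f := fun z : ℂ => ENNReal.ofReal (‖z‖ ^ 2) ^ (-θ)) (by fun_prop)]
  exact lintegral_normSq_rpow_neg_complexGaussian_lt_top hθ₁

theorem ae_ne_zero_complexGaussian : ∀ᵐ z ∂complexGaussian, z ≠ 0 := by
  have h := lintegral_normSq_rpow_neg_complexGaussian_lt_top (θ := 1 / 2) (by norm_num)
  filter_upwards [ae_lt_top (by fun_prop) h.ne] with z hz h₀
  simp [h₀] at hz

theorem ae_eval_ne_zero_gaussVec (i : ι) : ∀ᵐ u ∂gaussVec ι, u i ≠ 0 :=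
  (measurePreserving_eval (fun _ : ι => complexGaussian) i).quasiMeasurePreserving.ae
    ae_ne_zero_complexGaussian

variable [Fintype τ]

theorem measurable_rpow_neg_topDot (θ : ℝ) : Measurable fun q : (τ ⊕ β → ℂ) × (τ ⊕ β → ℂ) =>
    ENNReal.ofReal (‖topDot q.1 q.2‖ ^ 2) ^ (-θ) :=
  (measurable_topDot.norm.pow_const 2).ennreal_ofReal.pow_const _

variable [Fintype β]

theorem lintegral_rpow_neg_topDot_rejection_le {u : τ ⊕ β → ℂ} {t : τ} {b : β}
    (ht : u (Sum.inl t) ≠ 0) (hb : u (Sum.inr b) ≠ 0) (hθ : 0 ≤ θ) (hθ₁ : θ ≤ 1) :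
    ∫⁻ z, ENNReal.ofReal (‖topDot (rejection u z) u‖ ^ 2) ^ (-θ) ∂gaussVec (τ ⊕ β) ≤
      (ENNReal.ofReal (‖u (Sum.inl t)‖ ^ 2) ^ (-θ) + ENNReal.ofReal (‖u (Sum.inr b)‖ ^ 2) ^ (-θ)) *
        ∫⁻ z, ENNReal.ofReal (‖z‖ ^ 2) ^ (-θ) ∂complexGaussian := by
  have htop := norm_sq_le_normSq (u ∘ Sum.inl) t
  have hbot := norm_sq_le_normSq (u ∘ Sum.inr) b
  have htop₀ : 0 < normSq (u ∘ Sum.inl) := lt_of_lt_of_le (by positivity) htop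
  have hbot₀ : 0 < normSq (u ∘ Sum.inr) := lt_of_lt_of_le (by positivity) hbot
  simp_rw [norm_topDot_rejection]
  rw [lintegral_rpow_neg_star_dotProduct_gaussVec (topRejection_ne_zero ht hb), normSq_topRejection,
    ← normSq_comp_inl_add_normSq_comp_inr]
  gcongr
  exact (ofReal_mul_div_add_rpow_neg_le htop₀ hbot₀ hθ hθ₁).trans
    (add_le_add (ofReal_rpow_neg_anti hθ htop) (ofReal_rpow_neg_anti hθ hbot))

theorem lintegral_rpow_neg_topDot_gaussPair_lt_top [Nonempty τ] [Nonempty β] (hθ : 0 ≤ θ)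
    (hθ₁ : θ < 1) :
    ∫⁻ q, ENNReal.ofReal (‖topDot q.1 q.2‖ ^ 2) ^ (-θ) ∂gaussPair (τ ⊕ β) < ∞ := by
  obtain ⟨t⟩ := ‹Nonempty τ›
  obtain ⟨b⟩ := ‹Nonempty β›
  have hmeas := measurable_rpow_neg_topDot (τ := τ) (β := β) θ
  rw [gaussPair, lintegral_map hmeas measurable_rejection_pair,
    lintegral_prod (fun q => ENNReal.ofReal (‖topDot (rejection q.1 q.2) q.1‖ ^ 2) ^ (-θ))
      (hmeas.comp measurable_rejection_pair).aemeasurable]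
  refine (lintegral_mono_ae ?_).trans_lt (?_ : ∫⁻ u : τ ⊕ β → ℂ,
    (ENNReal.ofReal (‖u (Sum.inl t)‖ ^ 2) ^ (-θ) + ENNReal.ofReal (‖u (Sum.inr b)‖ ^ 2) ^ (-θ)) *
      ∫⁻ z, ENNReal.ofReal (‖z‖ ^ 2) ^ (-θ) ∂complexGaussian ∂gaussVec (τ ⊕ β) < ∞)
  · filter_upwards [ae_eval_ne_zero_gaussVec (Sum.inl t), ae_eval_ne_zero_gaussVec (Sum.inr b)]
      with u ht hb
    exact lintegral_rpow_neg_topDot_rejection_le ht hb hθ hθ₁.le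
  · rw [lintegral_mul_const _ (by fun_prop), lintegral_add_left (by fun_prop)]
    exact ENNReal.mul_lt_top (ENNReal.add_lt_top.2
      ⟨lintegral_rpow_neg_eval_gaussVec_lt_top _ hθ₁,
        lintegral_rpow_neg_eval_gaussVec_lt_top _ hθ₁⟩)
      (lintegral_normSq_rpow_neg_complexGaussian_lt_top hθ₁)

variable [DecidableEq τ] [DecidableEq β] {i j : τ ⊕ β}

theorem IsInvariantPair.lintegral_rpow_neg_topDot {ν : Measure ((τ ⊕ β → ℂ) × (τ ⊕ β → ℂ))}
    [SFinite ν] (hν : IsInvariantPair ν) (hij : i ≠ j) (θ : ℝ) :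
    ∫⁻ q, ENNReal.ofReal (‖topDot q.1 q.2‖ ^ 2) ^ (-θ) ∂ν =
      (∫⁻ q, ENNReal.ofReal (normSq q.1 * normSq q.2) ^ (-θ) ∂ν) *
        ∫⁻ p, ENNReal.ofReal (‖topDot p.1 p.2‖ ^ 2) ^ (-θ) ∂orthonormalPairLaw i j := by
  rw [hν.lintegral_eq hij (measurable_rpow_neg_topDot θ), ← lintegral_mul_const _ (by fun_prop)]
  refine lintegral_congr fun q => ?_
  simp_rw [norm_sq_topDot_smul, norm_sq_ofReal_sqrt_normSq]
  exact lintegral_rpow_neg_const_mul _ (mul_nonneg (normSq_nonneg _) (normSq_nonneg _))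
    (measurable_topDot.norm.pow_const 2) θ

theorem lintegral_rpow_neg_topDot_orthonormalPairLaw_lt_top [Nonempty τ] [Nonempty β]
    (hij : i ≠ j) (hθ : 0 ≤ θ) (hθ₁ : θ < 1) :
    ∫⁻ p, ENNReal.ofReal (‖topDot p.1 p.2‖ ^ 2) ^ (-θ) ∂orthonormalPairLaw i j < ∞ := by
  have h := lintegral_rpow_neg_topDot_gaussPair_lt_top (τ := τ) (β := β) hθ hθ₁
  rw [isInvariantPair_gaussPair.lintegral_rpow_neg_topDot hij] at h
  refine lt_top_iff_ne_top.2 fun htop =>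
    h.ne (ENNReal.mul_eq_top.2 (Or.inl ⟨fun hzero => ?_, htop⟩))
  rw [lintegral_eq_zero_iff (by fun_prop)] at hzero
  obtain ⟨q, hq⟩ := hzero.exists
  rcases ENNReal.rpow_eq_zero_iff.1 hq with ⟨-, hneg⟩ | ⟨htop', -⟩
  · linarith
  · exact ENNReal.ofReal_ne_top htop'

end PairMoment

section PairSmallBall

variable {ι τ β : Type*} [Fintype ι] [Fintype τ] [Fintype β]

theorem le_measure_prod_of_forall_ae_le {α γ : Type*} [MeasurableSpace α] [MeasurableSpace γ]
    {μ : Measure α} {ν : Measure γ} [SFinite ν] {E : Set (α × γ)} (hE : MeasurableSet E)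
    {A : Set α} {c : ℝ≥0∞}
    (h : ∀ᵐ x ∂μ, x ∈ A → c ≤ ν (Prod.mk x ⁻¹' E)) : μ A * c ≤ μ.prod ν E := by
  rw [Measure.prod_apply hE, mul_comm, ← setLIntegral_const]
  exact (setLIntegral_mono_ae (measurable_measure_prodMk_left hE).aemeasurable h).trans
    (setLIntegral_le_lintegral _ _)

theorem norm_sq_star_dotProduct_le_normSq_rejection {u f : ι → ℂ} (hf : normSq f = 1)
    (hfu : star u ⬝ᵥ f = 0) (z : ι → ℂ) : ‖star f ⬝ᵥ z‖ ^ 2 ≤ normSq (rejection u z) := by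
  rw [← rejection_of_orthogonal hfu, star_rejection_dotProduct]
  exact (norm_sq_star_dotProduct_le _ _).trans_eq (by rw [hf, one_mul])

theorem measurableSet_norm_sq_topDot_lt (s : ℝ) :
    MeasurableSet {q : (τ ⊕ β → ℂ) × (τ ⊕ β → ℂ) |
      ‖topDot q.1 q.2‖ ^ 2 < s * (normSq q.1 * normSq (q.2 ∘ Sum.inr))} :=
  measurableSet_lt (measurable_topDot.norm.pow_const 2) (by fun_prop)

theorem le_gaussVec_norm_sq_topDot_lt_of_nontrivial [Nontrivial τ] {u : τ ⊕ β → ℂ}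
    (hw : topRejection u ≠ 0) {s : ℝ} (hs : 0 ≤ s) :
    complexGaussian {z | ‖z‖ ^ 2 < s} * complexGaussian {z | 1 ≤ ‖z‖ ^ 2} ≤
      gaussVec (τ ⊕ β) {z | ‖topDot (rejection u z) u‖ ^ 2 <
        s * (normSq (rejection u z) * normSq (u ∘ Sum.inr))} := by
  obtain ⟨f, hf, hfu⟩ := exists_normSq_eq_one_star_dotProduct_eq_zero (u ∘ Sum.inl)
  set f' : τ ⊕ β → ℂ := Sum.elim f 0
  have hf' : normSq f' = 1 := (normSq_sumElim_zero f).trans hf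
  have hfu' : star f' ⬝ᵥ u = 0 := by
    simpa [f', dotProduct] using hfu
  have huf' : star u ⬝ᵥ f' = 0 := by rw [Matrix.star_dotProduct, hfu', star_zero]
  have hfw : star f' ⬝ᵥ topRejection u = 0 := by
    rw [topRejection, ← star_rejection_dotProduct, rejection_of_orthogonal huf',
      star_dotProduct_sumElim_zero]
    exact hfu
  obtain ⟨t, t', htt'⟩ := exists_pair_ne τ
  have hpair := measurePreserving_star_dotProduct_pair_gaussVec
    (Sum.inl_injective.ne htt' : (Sum.inl t : τ ⊕ β) ≠ Sum.inl t') (normSq_inv_sqrt_smul hw) hf'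
    (by rw [star_smul, smul_dotProduct, Matrix.star_dotProduct, hfw, star_zero, smul_zero])
  rw [← Measure.prod_prod, ← hpair.measure_preimage
    (by measurability : MeasurableSet _).nullMeasurableSet]
  refine measure_mono fun z hz => ?_
  obtain ⟨hlt, hle⟩ : ‖_‖ ^ 2 < s ∧ 1 ≤ ‖star f' ⬝ᵥ z‖ ^ 2 := hz
  have hrej := hle.trans (norm_sq_star_dotProduct_le_normSq_rejection hf' huf' z)
  rw [Set.mem_ofPred_eq, norm_topDot_rejection, norm_sq_star_dotProduct_eq_mul hw]
  calc normSq (topRejection u) * _ < normSq (topRejection u) * s :=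
        mul_lt_mul_of_pos_left hlt (normSq_pos hw)
    _ ≤ normSq (u ∘ Sum.inr) * s := by
        gcongr
        exact normSq_topRejection_le_normSq_comp_inr u
    _ = s * (1 * normSq (u ∘ Sum.inr)) := by ring
    _ ≤ s * (normSq (rejection u z) * normSq (u ∘ Sum.inr)) := by
        gcongr
        exact normSq_nonneg _

theorem le_gaussVec_norm_sq_topDot_lt_of_normSq_lt {u : τ ⊕ β → ℂ} (hw : topRejection u ≠ 0)
    {s : ℝ} (htop : normSq (u ∘ Sum.inl) < s) (hbot : 1 ≤ normSq (u ∘ Sum.inr)) :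
    complexGaussian {z | 1 ≤ ‖z‖ ^ 2} ≤
      gaussVec (τ ⊕ β) {z | ‖topDot (rejection u z) u‖ ^ 2 <
        s * (normSq (rejection u z) * normSq (u ∘ Sum.inr))} := by
  rw [← (measurePreserving_star_dotProduct_gaussVec (normSq_inv_sqrt_smul hw)).measure_preimage
    (by measurability : MeasurableSet _).nullMeasurableSet]
  refine measure_mono fun z hz => ?_
  have hone : 1 ≤ ‖_‖ ^ 2 := hz
  have hrej := norm_sq_star_dotProduct_le_normSq_rejection (normSq_inv_sqrt_smul hw)
    (by rw [dotProduct_smul, star_dotProduct_topRejection_self, smul_zero]) z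
  have hs : 0 < s := (normSq_nonneg _).trans_lt htop
  rw [Set.mem_ofPred_eq, norm_topDot_rejection, norm_sq_star_dotProduct_eq_mul hw]
  calc normSq (topRejection u) * _ < s * _ :=
        mul_lt_mul_of_pos_right ((normSq_topRejection_le_normSq_comp_inl u).trans_lt htop)
          (one_pos.trans_le hone)
    _ ≤ s * (normSq (rejection u z) * 1) := by rw [mul_one]; gcongr
    _ ≤ s * (normSq (rejection u z) * normSq (u ∘ Sum.inr)) := by
        gcongr
        exact normSq_nonneg _

theorem ae_topRejection_ne_zero_gaussVec [Nonempty τ] [Nonempty β] :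
    ∀ᵐ u ∂gaussVec (τ ⊕ β), topRejection u ≠ 0 := by
  obtain ⟨t⟩ := ‹Nonempty τ›
  obtain ⟨b⟩ := ‹Nonempty β›
  filter_upwards [ae_eval_ne_zero_gaussVec (Sum.inl t), ae_eval_ne_zero_gaussVec (Sum.inr b)]
    with u ht hb using topRejection_ne_zero ht hb

theorem le_gaussVec_normSq_comp_inl_lt [Nonempty τ] [Subsingleton τ] [Nonempty β] (s : ℝ) :
    complexGaussian {z | ‖z‖ ^ 2 < s} * complexGaussian {z | 1 ≤ ‖z‖ ^ 2} ≤
      gaussVec (τ ⊕ β) {u | normSq (u ∘ Sum.inl) < s ∧ 1 ≤ normSq (u ∘ Sum.inr)} := by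
  obtain ⟨t⟩ := ‹Nonempty τ›
  obtain ⟨b⟩ := ‹Nonempty β›
  rw [← Measure.prod_prod, ← (measurePreserving_eval_pair_gaussVec
    (Sum.inl_ne_inr : (Sum.inl t : τ ⊕ β) ≠ Sum.inr b)).measure_preimage
      (by measurability : MeasurableSet _).nullMeasurableSet]
  refine measure_mono fun u hu => ⟨?_, hu.2.trans (norm_sq_le_normSq (u ∘ Sum.inr) b)⟩
  rw [normSq, Fintype.sum_subsingleton _ t]
  exact hu.1

theorem le_gaussPair_norm_sq_topDot_lt [Nonempty τ] [Nonempty β] {s : ℝ} (hs : 0 ≤ s)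
    (hs₁ : s ≤ 1) :
    ENNReal.ofReal (Real.exp (-1) * s) * complexGaussian {z | 1 ≤ ‖z‖ ^ 2} ^ 2 ≤
      gaussPair (τ ⊕ β) {q | ‖topDot q.1 q.2‖ ^ 2 <
        s * (normSq q.1 * normSq (q.2 ∘ Sum.inr))} := by
  have hE := measurableSet_norm_sq_topDot_lt (τ := τ) (β := β) s
  rw [gaussPair, Measure.map_apply measurable_rejection_pair hE]
  refine (mul_le_mul_left (le_complexGaussian_setOf_norm_sq_lt hs hs₁) _).trans ?_
  rcases subsingleton_or_nontrivial τ with hτ | hτ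
  · rw [sq, ← mul_assoc]
    refine (mul_le_mul_left (le_gaussVec_normSq_comp_inl_lt (τ := τ) (β := β) s) _).trans ?_
    refine le_measure_prod_of_forall_ae_le (measurable_rejection_pair hE) ?_
    filter_upwards [ae_topRejection_ne_zero_gaussVec] with u hw hu
    exact le_gaussVec_norm_sq_topDot_lt_of_normSq_lt hw hu.1 hu.2
  · refine (mul_le_mul_right (pow_le_of_le_one zero_le prob_le_one two_ne_zero) _).trans ?_
    rw [← one_mul (_ * _), ← measure_univ (μ := gaussVec (τ ⊕ β))]
    refine le_measure_prod_of_forall_ae_le (measurable_rejection_pair hE) ?_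
    filter_upwards [ae_topRejection_ne_zero_gaussVec] with u hw _
    exact le_gaussVec_norm_sq_topDot_lt_of_nontrivial hw hs

theorem measurableSet_norm_sq_topDot_lt_normSq_comp_inr (s : ℝ) :
    MeasurableSet {q : (τ ⊕ β → ℂ) × (τ ⊕ β → ℂ) |
      ‖topDot q.1 q.2‖ ^ 2 < s * normSq (q.2 ∘ Sum.inr)} :=
  measurableSet_lt (measurable_topDot.norm.pow_const 2) (by fun_prop)

variable [DecidableEq τ] [DecidableEq β] [Nonempty τ] [Nonempty β] {i j : τ ⊕ β}

theorem le_orthonormalPairLaw_norm_sq_topDot_lt (hij : i ≠ j) {s : ℝ} (hs : 0 ≤ s) (hs₁ : s ≤ 1) :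
    ENNReal.ofReal (Real.exp (-1) * s) * complexGaussian {z | 1 ≤ ‖z‖ ^ 2} ^ 2 ≤
      orthonormalPairLaw i j {p | ‖topDot p.1 p.2‖ ^ 2 < s * normSq (p.2 ∘ Sum.inr)} := by
  refine (le_gaussPair_norm_sq_topDot_lt (τ := τ) (β := β) hs hs₁).trans ?_
  rw [isInvariantPair_gaussPair.measure_eq_lintegral hij (measurableSet_norm_sq_topDot_lt s)]
  rw [← mul_one (orthonormalPairLaw i j _), ← measure_univ (μ := gaussPair (τ ⊕ β)),
    ← lintegral_const]
  refine lintegral_mono fun q => measure_mono_ae ?_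
  filter_upwards [ae_normSq_fst_orthonormalPairLaw i j] with p hp hlt
  have hlt' : ‖topDot _ _‖ ^ 2 < s * (normSq (_ • p.1) * normSq ((_ • p.2) ∘ Sum.inr)) := hlt
  rw [norm_sq_topDot_smul, normSq_smul, hp, mul_one, normSq_smul_comp_inr,
    ← mul_assoc (‖_‖ ^ 2) (‖_‖ ^ 2), mul_left_comm] at hlt'
  exact lt_of_mul_lt_mul_left hlt' (by positivity)

theorem IsInvariantPair.le_norm_sq_topDot_lt {ν : Measure ((τ ⊕ β → ℂ) × (τ ⊕ β → ℂ))} [SFinite ν]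
    (hν : IsInvariantPair ν) (hij : i ≠ j) {A s : ℝ} (hA : 0 < A) (hs : 0 ≤ s) (hsA : s ≤ A) :
    ENNReal.ofReal (Real.exp (-1) * (s / A)) * complexGaussian {z | 1 ≤ ‖z‖ ^ 2} ^ 2 *
        ν {q | normSq q.1 ≤ A ∧ q.2 ≠ 0} ≤
      ν {q | ‖topDot q.1 q.2‖ ^ 2 < s * normSq (q.2 ∘ Sum.inr)} := by
  rw [hν.measure_eq_lintegral hij (measurableSet_norm_sq_topDot_lt_normSq_comp_inr s),
    ← setLIntegral_const]
  have hmeas : MeasurableSet {q : (τ ⊕ β → ℂ) × (τ ⊕ β → ℂ) | normSq q.1 ≤ A ∧ q.2 ≠ 0} :=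
    (measurableSet_le (measurable_normSq.comp measurable_fst) measurable_const).inter
      (measurable_snd (measurableSet_singleton 0).compl)
  refine (setLIntegral_mono_ae' hmeas (ae_of_all _ fun q hq => ?_)).trans
    (setLIntegral_le_lintegral _ _)
  refine (le_orthonormalPairLaw_norm_sq_topDot_lt hij (by positivity)
    ((div_le_one hA).2 hsA)).trans (measure_mono fun p hp => ?_)
  have hpos := normSq_pos hq.2
  rw [Set.mem_ofPred_eq, Set.mem_ofPred_eq, norm_sq_topDot_smul, normSq_smul_comp_inr,
    norm_sq_ofReal_sqrt_normSq, norm_sq_ofReal_sqrt_normSq]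
  have hp' : A * ‖topDot p.1 p.2‖ ^ 2 < s * normSq (p.2 ∘ Sum.inr) := by
    rw [mul_comm A, ← lt_div_iff₀ hA, ← div_mul_eq_mul_div]
    exact hp
  calc normSq q.1 * normSq q.2 * ‖topDot p.1 p.2‖ ^ 2
      ≤ normSq q.2 * (A * ‖topDot p.1 p.2‖ ^ 2) := by
        rw [mul_comm (normSq q.1), mul_assoc]
        gcongr
        exact hq.1
    _ < normSq q.2 * (s * normSq (p.2 ∘ Sum.inr)) := mul_lt_mul_of_pos_left hp' hpos
    _ = s * (normSq q.2 * normSq (p.2 ∘ Sum.inr)) := by ring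

end PairSmallBall

section RandomDeterminant

variable {κ : Type*} [DecidableEq κ]

theorem measurable_update_pair {Y : κ → Type*} [∀ i, MeasurableSpace (Y i)] (m : κ) :
    Measurable fun p : (∀ i, Y i) × Y m => Function.update p.1 m p.2 := by
  refine measurable_pi_lambda _ fun i => ?_
  obtain rfl | h := eq_or_ne i m
  · simpa using measurable_snd
  · simp only [Function.update_of_ne h]
    exact (measurable_pi_apply i).comp measurable_fst

/-- The identity matrix with the columns in `s` replaced by the vectors `v i`; it interpolates
between the identity and the matrix with columns `v`, one column at a time. -/
def partialCols (s : Finset κ) (v : κ → κ → ℂ) : Matrix κ κ ℂ :=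
  Matrix.of fun j i => if i ∈ s then v i j else (1 : Matrix κ κ ℂ) j i

theorem partialCols_insert_update (s : Finset κ) (v : κ → κ → ℂ) (i : κ) (b : κ → ℂ) :
    partialCols (insert i s) (Function.update v i b) = (partialCols s v).updateCol i b := by
  ext j l
  obtain rfl | hl := eq_or_ne l i
  · simp [partialCols]
  · simp [partialCols, hl]

variable [Fintype κ]

theorem measurePreserving_update {Y : κ → Type*} [∀ i, MeasurableSpace (Y i)]
    (ν : ∀ i, Measure (Y i)) [∀ i, IsProbabilityMeasure (ν i)] (m : κ) :
    MeasurePreserving (fun p : (∀ i, Y i) × Y m => Function.update p.1 m p.2)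
      ((Measure.pi ν).prod (ν m)) (Measure.pi ν) := by
  refine ⟨measurable_update_pair m, (Measure.pi_eq fun s hs => ?_).symm⟩
  rw [Measure.map_apply (measurable_update_pair m) (MeasurableSet.univ_pi hs)]
  have preimage_box : (fun p : (∀ i, Y i) × Y m => Function.update p.1 m p.2) ⁻¹' Set.univ.pi s =
      (Set.univ.pi (Function.update s m Set.univ)) ×ˢ s m := by
    ext ⟨y, t⟩
    simp only [Set.mem_preimage, Set.mem_univ_pi, Set.mem_prod, Function.forall_update_iff,
      Function.forall_update_iff s fun i a => y i ∈ a, Set.mem_univ, true_and]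
    exact and_comm
  rw [preimage_box, Measure.prod_prod, Measure.pi_pi,
    ← Finset.mul_prod_erase _ _ (Finset.mem_univ m),
    ← Finset.mul_prod_erase _ (fun i => ν i (s i)) (Finset.mem_univ m), Function.update_self,
    measure_univ, one_mul, mul_comm]
  congr 1
  exact Finset.prod_congr rfl fun i hi => by rw [Function.update_of_ne (Finset.ne_of_mem_erase hi)]

theorem det_updateCol_eq_adjugate_dotProduct (A : Matrix κ κ ℂ) (i : κ) (b : κ → ℂ) :
    (A.updateCol i b).det = A.adjugate i ⬝ᵥ b := by
  rw [← Matrix.cramer_apply, Matrix.cramer_eq_adjugate_mulVec]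
  rfl

theorem adjugate_dotProduct_col (A : Matrix κ κ ℂ) (i : κ) :
    (A.adjugate i ⬝ᵥ fun j => A j i) = A.det := by
  rw [← det_updateCol_eq_adjugate_dotProduct, Matrix.updateCol_eq_self]

theorem adjugate_updateCol_self (A : Matrix κ κ ℂ) (i : κ) (b : κ → ℂ) :
    (A.updateCol i b).adjugate i = A.adjugate i := by
  ext j
  have adjugate_apply_eq_det (B : Matrix κ κ ℂ) :
      B.adjugate i j = (B.updateCol i (Pi.single j 1)).det := by
    rw [det_updateCol_eq_adjugate_dotProduct, dotProduct_single_one]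
  rw [adjugate_apply_eq_det, adjugate_apply_eq_det, Matrix.updateCol_idem]

theorem adjugate_ne_zero_of_det_ne_zero {A : Matrix κ κ ℂ} (hA : A.det ≠ 0) (i : κ) :
    A.adjugate i ≠ 0 := fun h => hA (by rw [← adjugate_dotProduct_col A i, h, zero_dotProduct])

theorem inv_mul_inv_conjTranspose_diag_re (A : Matrix κ κ ℂ) (i : κ) :
    ((A⁻¹ * (A⁻¹)ᴴ) i i).re = normSq (A.adjugate i) / ‖A.det‖ ^ 2 := by
  rw [Matrix.mul_apply, normSq, Finset.sum_div, Complex.re_sum]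
  refine Finset.sum_congr rfl fun j _ => ?_
  rw [Matrix.conjTranspose_apply, Matrix.inv_def, Ring.inverse_eq_inv, Matrix.smul_apply,
    smul_eq_mul, RCLike.star_def, Complex.mul_conj', ← Complex.ofReal_pow, Complex.ofReal_re,
    norm_mul, norm_inv, mul_pow, inv_pow, div_eq_inv_mul]

theorem measurable_matrix_of {α m n : Type*} [MeasurableSpace α] {f : α → m → n → ℂ}
    (hf : ∀ i j, Measurable fun a => f a i j) : Measurable fun a => Matrix.of (f a) :=
  measurable_pi_lambda (X := fun _ : m => n → ℂ) _ fun i => measurable_pi_lambda _ fun j => hf i j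

theorem measurable_det : Measurable (Matrix.det : Matrix κ κ ℂ → ℂ) :=
  (continuous_id.matrix_det).measurable

variable {Y : κ → Type*} [∀ i, MeasurableSpace (Y i)] (ν : ∀ i, Measure (Y i))
  [∀ i, IsProbabilityMeasure (ν i)]

theorem ae_det_partialCols_ne_zero {g : ∀ i, Y i → κ → ℂ} (hg : ∀ i, Measurable (g i))
    (h : ∀ i, ∀ c : κ → ℂ, c ≠ 0 → ∀ᵐ y ∂ν i, c ⬝ᵥ g i y ≠ 0) (s : Finset κ) :
    ∀ᵐ y ∂Measure.pi ν, (partialCols s fun i => g i (y i)).det ≠ 0 := by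
  induction s using Finset.induction_on with
  | empty =>
    refine ae_of_all _ fun y => ?_
    have empty_eq_one : (partialCols ∅ fun i => g i (y i)) = 1 := by ext i j; simp [partialCols]
    rw [empty_eq_one, Matrix.det_one]
    exact one_ne_zero
  | insert i s _ ih =>
    have measurable_partialCols :
        Measurable fun y : ∀ i, Y i => partialCols (insert i s) fun i => g i (y i) := by
      refine measurable_matrix_of fun j l => ?_
      exact (((measurable_pi_apply j).comp (hg l)).comp (measurable_pi_apply l)).ite
        (MeasurableSet.const _) measurable_const
    have hS : MeasurableSet
        {y : ∀ i, Y i | (partialCols (insert i s) fun i => g i (y i)).det ≠ 0} :=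
      (measurableSet_eq_fun (measurable_det.comp measurable_partialCols) measurable_const).compl
    rw [← (measurePreserving_update ν i).map_eq,
      ae_map_iff (measurable_update_pair i).aemeasurable hS]
    refine (Measure.ae_prod_iff_ae_ae (measurable_update_pair i hS)).2 ?_
    filter_upwards [ih] with y hy
    filter_upwards [h i _ (adjugate_ne_zero_of_det_ne_zero hy i)] with t ht
    have comp_update : (fun l => g l (Function.update y i t l)) =
        Function.update (fun l => g l (y l)) i (g i t) := by
      ext1 l
      exact Function.apply_update (fun l => g l) y i t l
    rwa [comp_update, partialCols_insert_update, det_updateCol_eq_adjugate_dotProduct]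

theorem ae_det_ne_zero {g : ∀ i, Y i → κ → ℂ} (hg : ∀ i, Measurable (g i))
    (h : ∀ i, ∀ c : κ → ℂ, c ≠ 0 → ∀ᵐ y ∂ν i, c ⬝ᵥ g i y ≠ 0) :
    ∀ᵐ y ∂Measure.pi ν, (Matrix.of fun j i => g i (y i) j).det ≠ 0 := by
  filter_upwards [ae_det_partialCols_ne_zero ν hg h Finset.univ] with y hy
  simpa only [partialCols, Finset.mem_univ, if_true] using hy

end RandomDeterminant

section UniformSphere

variable {k : ℕ}

theorem measurable_normalize : Measurable fun (z : Fin k → ℂ) i =>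
    ((√2 / √(normSq z) : ℝ) : ℂ) * z i := by
  fun_prop

instance isProbabilityMeasure_uniformSphere : IsProbabilityMeasure (uniformSphere k) :=
  Measure.isProbabilityMeasure_map (μ := gaussVec (Fin k)) measurable_normalize.aemeasurable

theorem measurePreserving_unitary_uniformSphere (R : Matrix.unitaryGroup (Fin k) ℂ) :
    MeasurePreserving (fun x : Fin k → ℂ => (R : Matrix (Fin k) (Fin k) ℂ) *ᵥ x)
      (uniformSphere k) (uniformSphere k) := by
  have hR := measurePreserving_unitary_gaussVec R
  refine ⟨hR.measurable, ?_⟩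
  change ((gaussVec (Fin k)).map _).map _ = (gaussVec (Fin k)).map _
  rw [Measure.map_map hR.measurable measurable_normalize]
  conv_rhs => rw [← hR.map_eq, Measure.map_map measurable_normalize hR.measurable]
  congr 1
  ext1 z
  simp only [Function.comp_apply, normSq_mulVec (unitary_conjTranspose_mul R)]
  exact Matrix.mulVec_smul (R : Matrix (Fin k) (Fin k) ℂ) ((√2 / √(normSq z) : ℝ) : ℂ) z

theorem ae_normSq_uniformSphere (hk : 0 < k) : ∀ᵐ x ∂uniformSphere k, normSq x = 2 := by
  change ∀ᵐ x ∂((gaussVec (Fin k)).map _), normSq x = 2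
  rw [ae_map_iff measurable_normalize.aemeasurable
    (measurableSet_eq_fun measurable_normSq measurable_const)]
  filter_upwards [ae_eval_ne_zero_gaussVec (⟨0, hk⟩ : Fin k)] with z hz
  have hz' : 0 < normSq z := normSq_pos fun h => hz (congrFun h _)
  refine (normSq_smul ((√2 / √(normSq z) : ℝ) : ℂ) z).trans ?_
  rw [Complex.norm_real, Real.norm_eq_abs, sq_abs, div_pow, Real.sq_sqrt hz'.le,
    Real.sq_sqrt zero_le_two, div_mul_cancel₀ _ hz'.ne']

end UniformSphere

section FullRank

variable {ι κ : Type*} [Fintype ι] [Fintype κ]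

theorem measurePreserving_comp_injective {α : Type*} [MeasurableSpace α] (P : Measure α)
    [IsProbabilityMeasure P] {e : κ → ι} (he : Function.Injective e) :
    MeasurePreserving (fun (x : ι → α) j => x (e j)) (Measure.pi fun _ => P)
      (Measure.pi fun _ => P) := by
  have indep_eval : iIndepFun (fun i (x : ι → α) => x i) (Measure.pi fun _ => P) :=
    iIndepFun_pi (X := fun _ => id) fun _ => aemeasurable_id
  have map_eq_pi := (iIndepFun_iff_map_fun_eq_pi_map fun j =>
    (measurable_pi_apply (e j)).aemeasurable).1 (indep_eval.precomp he)
  refine ⟨measurable_pi_lambda _ fun j => measurable_pi_apply (e j), map_eq_pi.trans ?_⟩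
  congr 1
  ext1 j
  exact (measurePreserving_eval (fun _ : ι => P) (e j)).map_eq

theorem ae_dotProduct_ne_zero_gaussVec {c : κ → ℂ} (hc : c ≠ 0) :
    ∀ᵐ z ∂gaussVec κ, c ⬝ᵥ z ≠ 0 := by
  have hc' : star c ≠ 0 := star_ne_zero.2 hc
  have ae_normalized := (measurePreserving_star_dotProduct_gaussVec
    (normSq_inv_sqrt_smul hc')).quasiMeasurePreserving.ae ae_ne_zero_complexGaussian
  filter_upwards [ae_normalized] with z hz h₀
  have h := norm_sq_star_dotProduct_eq_mul hc' z
  rw [star_star, h₀, norm_zero, zero_pow two_ne_zero, zero_eq_mul] at h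
  exact h.elim (normSq_pos hc').ne' fun h => hz (norm_eq_zero.1 (eq_zero_of_pow_eq_zero h))

theorem ae_rank_eq_gaussMat (hκ : Fintype.card κ ≤ Fintype.card ι) :
    ∀ᵐ K ∂gaussMat ι κ, K.rank = Fintype.card κ := by
  classical
  obtain ⟨e⟩ := Function.Embedding.nonempty_of_card_le hκ
  have ae_det_rows := (measurePreserving_comp_injective (Measure.pi fun _ : κ => complexGaussian)
    e.injective).quasiMeasurePreserving.ae <| ae_det_ne_zero (fun _ : κ => gaussVec κ)
      (g := fun _ z => z) (fun _ => measurable_id) fun _ c hc => ae_dotProduct_ne_zero_gaussVec hc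
  filter_upwards [ae_det_rows] with K hK
  have det_submatrix_ne_zero : (K.submatrix e id).det ≠ 0 := by
    rw [← Matrix.det_transpose]
    exact hK
  have injective_mulVecLin : Function.Injective K.mulVecLin := by
    refine (injective_iff_map_eq_zero _).2 fun v hv =>
      Matrix.eq_zero_of_mulVec_eq_zero det_submatrix_ne_zero ?_
    ext j
    exact congrFun hv (e j)
  rw [Matrix.rank, LinearMap.finrank_range_of_inj injective_mulVecLin,
    Module.finrank_fintype_fun_eq_card]

end FullRank

section Frame

theorem measurable_mulVec_const {ι κ : Type*} [Countable ι] [Fintype κ] (n : κ → ℂ) :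
    Measurable fun K : Matrix ι κ ℂ => K *ᵥ n :=
  (by fun_prop : Continuous fun K : Matrix ι κ ℂ => K *ᵥ n).measurable

variable {ι κ : Type*} [Fintype ι] {k : ℕ}

/-- A measurable choice, for every matrix `K`, of `k` orthonormal vectors orthogonal to the columns
of `K`. -/
structure IsNullFrame (T : Matrix ι κ ℂ → Matrix ι (Fin k) ℂ) : Prop where
  measurable : Measurable T
  orthonormal : ∀ K, (T K)ᴴ * T K = 1
  null : ∀ K, Kᴴ * T K = 0

theorem IsNullFrame.measurable_mulVec {T : Matrix ι κ ℂ → Matrix ι (Fin k) ℂ}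
    (hT : IsNullFrame T) :
    Measurable fun p : Matrix ι κ ℂ × (Fin k → ℂ) => T p.1 *ᵥ p.2 := by
  have h : Continuous fun p : Matrix ι (Fin k) ℂ × (Fin k → ℂ) => p.1 *ᵥ p.2 := by fun_prop
  exact h.measurable.comp ((hT.measurable.comp measurable_fst).prodMk measurable_snd)

theorem IsNullFrame.conj_unitary [Countable κ] [DecidableEq ι]
    {T : Matrix ι κ ℂ → Matrix ι (Fin k) ℂ} (hT : IsNullFrame T) (V : Matrix.unitaryGroup ι ℂ) :
    IsNullFrame fun K => (V : Matrix ι ι ℂ) * T ((V : Matrix ι ι ℂ)ᴴ * K) where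
  measurable := by
    have continuous_left : Continuous fun K : Matrix ι κ ℂ => (V : Matrix ι ι ℂ)ᴴ * K := by
      fun_prop
    have continuous_right : Continuous fun K : Matrix ι (Fin k) ℂ => (V : Matrix ι ι ℂ) * K := by
      fun_prop
    exact continuous_right.measurable.comp (hT.measurable.comp continuous_left.measurable)
  orthonormal K := by
    rw [Matrix.conjTranspose_mul, Matrix.mul_assoc, ← Matrix.mul_assoc _ (V : Matrix ι ι ℂ),
      unitary_conjTranspose_mul, Matrix.one_mul, hT.orthonormal]
  null K := by
    have h := hT.null ((V : Matrix ι ι ℂ)ᴴ * K)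
    rwa [Matrix.conjTranspose_mul, Matrix.conjTranspose_conjTranspose, Matrix.mul_assoc] at h

variable [Fintype κ]

theorem injective_mulVecLin_of_orthonormal {T : Matrix ι κ ℂ} [DecidableEq κ] (hT : Tᴴ * T = 1) :
    Function.Injective T.mulVecLin :=
  Function.LeftInverse.injective (g := Tᴴ.mulVecLin) fun v => by
    rw [Matrix.mulVecLin_apply, Matrix.mulVecLin_apply, Matrix.mulVec_mulVec, hT, Matrix.one_mulVec]

open scoped ComplexOrder in
theorem range_mulVecLin_eq_ker_conjTranspose {K : Matrix ι κ ℂ} {T : Matrix ι (Fin k) ℂ}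
    (hcard : Fintype.card κ + k = Fintype.card ι) (hK : K.rank = Fintype.card κ)
    (hT : Tᴴ * T = 1) (hKT : Kᴴ * T = 0) :
    LinearMap.range T.mulVecLin = LinearMap.ker Kᴴ.mulVecLin := by
  refine Submodule.eq_of_le_of_finrank_eq ?_ ?_
  · rintro _ ⟨x, rfl⟩
    simp [Matrix.mulVec_mulVec, hKT]
  · have rank_nullity := LinearMap.finrank_range_add_finrank_ker Kᴴ.mulVecLin
    have finrank_range : Module.finrank ℂ (LinearMap.range Kᴴ.mulVecLin) = Fintype.card κ := by
      rw [← hK, ← Matrix.rank_conjTranspose]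
      rfl
    rw [finrank_range, Module.finrank_fintype_fun_eq_card] at rank_nullity
    rw [LinearMap.finrank_range_of_inj (injective_mulVecLin_of_orthonormal hT),
      Module.finrank_fintype_fun_eq_card, Fintype.card_fin]
    omega

theorem mul_conjTranspose_mul_of_null_frame {K : Matrix ι κ ℂ} {T T' : Matrix ι (Fin k) ℂ}
    (hcard : Fintype.card κ + k = Fintype.card ι) (hK : K.rank = Fintype.card κ)
    (hT : Tᴴ * T = 1) (hKT : Kᴴ * T = 0) (hKT' : Kᴴ * T' = 0) : T * (Tᴴ * T') = T' := by
  refine Matrix.ext_of_mulVec_single fun j => ?_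
  obtain ⟨y, hy⟩ : T' *ᵥ Pi.single j 1 ∈ LinearMap.range T.mulVecLin := by
    rw [range_mulVecLin_eq_ker_conjTranspose hcard hK hT hKT, LinearMap.mem_ker,
      Matrix.mulVecLin_apply, Matrix.mulVec_mulVec, hKT', Matrix.zero_mulVec]
  rw [Matrix.mulVecLin_apply] at hy
  rw [← Matrix.mulVec_mulVec, ← Matrix.mulVec_mulVec, ← hy, Matrix.mulVec_mulVec y, hT,
    Matrix.one_mulVec]

/-- The law of `(K n, T(K) x)`, for a Gaussian matrix `K` and an independent `x` uniform on the
sphere. -/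
noncomputable def frameLaw (T : Matrix ι κ ℂ → Matrix ι (Fin k) ℂ) (n : κ → ℂ) :
    Measure ((ι → ℂ) × (ι → ℂ)) :=
  ((gaussMat ι κ).prod (uniformSphere k)).map fun p => (p.1 *ᵥ n, T p.1 *ᵥ p.2)

instance isFiniteMeasure_frameLaw (T : Matrix ι κ ℂ → Matrix ι (Fin k) ℂ) (n : κ → ℂ) :
    IsFiniteMeasure (frameLaw T n) :=
  inferInstanceAs (IsFiniteMeasure (Measure.map _ _))

variable {T T' : Matrix ι κ ℂ → Matrix ι (Fin k) ℂ}

theorem IsNullFrame.measurable_pair (hT : IsNullFrame T) (n : κ → ℂ) :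
    Measurable fun p : Matrix ι κ ℂ × (Fin k → ℂ) => (p.1 *ᵥ n, T p.1 *ᵥ p.2) :=
  ((measurable_mulVec_const n).comp measurable_fst).prodMk hT.measurable_mulVec

theorem IsNullFrame.frameLaw_eq (hT : IsNullFrame T) (hT' : IsNullFrame T')
    (hcard : Fintype.card κ + k = Fintype.card ι) (n : κ → ℂ) : frameLaw T' n = frameLaw T n := by
  ext S hS
  rw [frameLaw, frameLaw, Measure.map_apply (hT'.measurable_pair n) hS,
    Measure.map_apply (hT.measurable_pair n) hS, Measure.prod_apply (hT'.measurable_pair n hS),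
    Measure.prod_apply (hT.measurable_pair n hS)]
  refine lintegral_congr_ae ?_
  filter_upwards [ae_rank_eq_gaussMat (ι := ι) (κ := κ) (by omega)] with K hK
  -- For fixed `K` the two frames differ by the unitary matrix `R`, which preserves the law of `x`.
  have hR := mul_conjTranspose_mul_of_null_frame hcard hK (hT.orthonormal K) (hT.null K)
    (hT'.null K)
  have unitary_R : ((T K)ᴴ * T' K)ᴴ * ((T K)ᴴ * T' K) = 1 := by
    rw [Matrix.conjTranspose_mul, Matrix.conjTranspose_conjTranspose, Matrix.mul_assoc, hR,
      hT'.orthonormal]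
  let R : Matrix.unitaryGroup (Fin k) ℂ := ⟨_, Matrix.mem_unitaryGroup_iff'.2 unitary_R⟩
  rw [← (measurePreserving_unitary_uniformSphere R).measure_preimage
    (measurable_prodMk_left (hT.measurable_pair n hS)).nullMeasurableSet]
  congr 1
  ext x
  simp only [Set.mem_preimage, R]
  rw [Matrix.mulVec_mulVec, hR]

theorem IsNullFrame.measurePreserving_unitary [DecidableEq ι] (hT : IsNullFrame T)
    (hcard : Fintype.card κ + k = Fintype.card ι) (n : κ → ℂ) (V : Matrix.unitaryGroup ι ℂ) :
    MeasurePreserving (fun q : (ι → ℂ) × (ι → ℂ) =>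
      ((V : Matrix ι ι ℂ) *ᵥ q.1, (V : Matrix ι ι ℂ) *ᵥ q.2)) (frameLaw T n) (frameLaw T n) := by
  have hV : Measurable fun q : (ι → ℂ) × (ι → ℂ) =>
      ((V : Matrix ι ι ℂ) *ᵥ q.1, (V : Matrix ι ι ℂ) *ᵥ q.2) :=
    measurable_unitary_mulVec_pair.comp (measurable_const.prodMk measurable_id)
  have hprod := (measurePreserving_unitary_gaussMat (κ := κ) V).prod
    (MeasurePreserving.id (uniformSphere k))
  refine ⟨hV, ?_⟩
  conv_rhs => rw [← hT.frameLaw_eq (hT.conj_unitary V) hcard n, frameLaw, ← hprod.map_eq,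
    Measure.map_map ((hT.conj_unitary V).measurable_pair n) hprod.measurable]
  rw [frameLaw, Measure.map_map hV (hT.measurable_pair n)]
  congr 1
  ext1 p
  simp only [Function.comp_apply, Prod.map_fst, Prod.map_snd, id_eq]
  rw [← Matrix.mul_assoc, unitary_conjTranspose_mul, Matrix.one_mul, Matrix.mulVec_mulVec,
    Matrix.mulVec_mulVec]

theorem IsNullFrame.isInvariantPair_frameLaw [DecidableEq ι] (hT : IsNullFrame T)
    (hcard : Fintype.card κ + k = Fintype.card ι) (n : κ → ℂ) :
    IsInvariantPair (frameLaw T n) where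
  invariant := hT.measurePreserving_unitary hcard n
  orthogonal := by
    have hm : MeasurableSet {q : (ι → ℂ) × (ι → ℂ) | star q.1 ⬝ᵥ q.2 = 0} := by
      refine measurableSet_eq_fun ?_ measurable_const
      simp only [dotProduct, Pi.star_apply]
      fun_prop
    rw [frameLaw, ae_map_iff (hT.measurable_pair n).aemeasurable hm]
    refine ae_of_all _ fun p => ?_
    rw [Matrix.star_mulVec, ← Matrix.dotProduct_mulVec, Matrix.mulVec_mulVec, hT.null,
      Matrix.zero_mulVec, dotProduct_zero]

theorem IsNullFrame.ae_normSq_snd_frameLaw (hT : IsNullFrame T) (hk : 0 < k) (n : κ → ℂ) :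
    ∀ᵐ q ∂frameLaw T n, normSq q.2 = 2 := by
  rw [frameLaw, ae_map_iff (hT.measurable_pair n).aemeasurable
    (measurableSet_eq_fun (by fun_prop) measurable_const)]
  filter_upwards [Measure.quasiMeasurePreserving_snd.ae (ae_normSq_uniformSphere hk)] with p hp
  rw [normSq_mulVec (hT.orthonormal p.1), hp]

end Frame

section FrameEstimates

variable {ι κ τ β : Type*} [Fintype ι] [Fintype κ] {k : ℕ} {θ : ℝ}

theorem normSq_mulVec_le (K : Matrix ι κ ℂ) (n : κ → ℂ) :
    normSq (K *ᵥ n) ≤ (∑ i, normSq (K i)) * normSq n := by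
  rw [Finset.sum_mul]
  refine Finset.sum_le_sum fun i _ => ?_
  have := norm_sq_star_dotProduct_le (star (K i)) n
  rwa [star_star, normSq_star] at this

theorem lintegral_rpow_neg_mulVec_eval_gaussMat {n : κ → ℂ} (hn : n ≠ 0) (i : ι) (θ : ℝ) :
    ∫⁻ K, ENNReal.ofReal (‖(K *ᵥ n) i‖ ^ 2) ^ (-θ) ∂gaussMat ι κ =
      ENNReal.ofReal (normSq n) ^ (-θ) *
        ∫⁻ z, ENNReal.ofReal (‖z‖ ^ 2) ^ (-θ) ∂complexGaussian := by
  have row_i : MeasurePreserving (fun K : Matrix ι κ ℂ => K i) (gaussMat ι κ) (gaussVec κ) :=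
    measurePreserving_eval (fun _ : ι => Measure.pi fun _ : κ => complexGaussian) i
  rw [← normSq_star n, ← lintegral_rpow_neg_star_dotProduct_gaussVec (star_ne_zero.2 hn) θ,
    ← row_i.lintegral_comp
      (((measurable_star_dotProduct _).norm.pow_const 2).ennreal_ofReal.pow_const _)]
  refine lintegral_congr fun K => ?_
  rw [star_star, dotProduct_comm]
  rfl

theorem IsNullFrame.lintegral_rpow_neg_frameLaw_le {T : Matrix ι κ ℂ → Matrix ι (Fin k) ℂ}
    (hT : IsNullFrame T) (hk : 0 < k) (hθ : 0 ≤ θ) {n : κ → ℂ} (hn : n ≠ 0) (i : ι) :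
    ∫⁻ q, ENNReal.ofReal (normSq q.1 * normSq q.2) ^ (-θ) ∂frameLaw T n ≤
      ENNReal.ofReal (normSq n) ^ (-θ) *
        ∫⁻ z, ENNReal.ofReal (‖z‖ ^ 2) ^ (-θ) ∂complexGaussian := by
  have measurable_rpow_neg : Measurable fun K : Matrix ι κ ℂ =>
      ENNReal.ofReal (‖(K *ᵥ n) i‖ ^ 2) ^ (-θ) :=
    ((((measurable_pi_apply _).comp
      (measurable_mulVec_const n)).norm.pow_const 2).ennreal_ofReal).pow_const _
  calc ∫⁻ q, ENNReal.ofReal (normSq q.1 * normSq q.2) ^ (-θ) ∂frameLaw T n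
      ≤ ∫⁻ q, ENNReal.ofReal (‖q.1 i‖ ^ 2) ^ (-θ) ∂frameLaw T n := by
        refine lintegral_mono_ae ?_
        filter_upwards [hT.ae_normSq_snd_frameLaw hk n] with q hq
        refine ofReal_rpow_neg_anti hθ ?_
        rw [hq]
        linarith [norm_sq_le_normSq q.1 i, normSq_nonneg q.1]
    _ = ∫⁻ K, ENNReal.ofReal (‖(K *ᵥ n) i‖ ^ 2) ^ (-θ) ∂gaussMat ι κ := by
        rw [frameLaw, lintegral_map (by fun_prop) (hT.measurable_pair n),
          ← (measurePreserving_fst (ν := uniformSphere k)).lintegral_comp measurable_rpow_neg]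
    _ = _ := lintegral_rpow_neg_mulVec_eval_gaussMat hn i θ

theorem exists_pos_measure_setOf_le {α : Type*} [MeasurableSpace α] (μ : Measure α) [NeZero μ]
    (f : α → ℝ) : ∃ L : ℝ, 1 ≤ L ∧ 0 < μ {a | f a ≤ L} := by
  have union_eq_univ : ⋃ L : ℕ, {a | f a ≤ L + 1} = Set.univ := by
    refine Set.eq_univ_of_forall fun a => Set.mem_iUnion.2 ?_
    obtain ⟨L, hL⟩ := exists_nat_ge (f a)
    exact ⟨L, hL.trans (by linarith)⟩
  obtain ⟨L, hL⟩ := exists_measure_pos_of_not_measure_iUnion_null (μ := μ)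
    (s := fun L : ℕ => {a | f a ≤ L + 1}) (by rw [union_eq_univ]; exact NeZero.ne _)
  exact ⟨L + 1, by simp, hL⟩

theorem IsNullFrame.le_frameLaw_normSq_fst_le {T : Matrix ι κ ℂ → Matrix ι (Fin k) ℂ}
    (hT : IsNullFrame T) (hk : 0 < k) (n : κ → ℂ) (L : ℝ) :
    gaussMat ι κ {K | ∑ i, normSq (K i) ≤ L} ≤
      frameLaw T n {q | normSq q.1 ≤ L * normSq n ∧ q.2 ≠ 0} := by
  have measurable_frobenius : Measurable fun K : Matrix ι κ ℂ => ∑ i, normSq (K i) :=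
    Finset.measurable_sum _ fun i _ => measurable_normSq.comp (measurable_pi_apply i)
  have drop_ne_zero : frameLaw T n {q | normSq q.1 ≤ L * normSq n ∧ q.2 ≠ 0} =
      frameLaw T n {q | normSq q.1 ≤ L * normSq n} := by
    refine measure_congr ?_
    filter_upwards [hT.ae_normSq_snd_frameLaw hk n] with q hq
    refine propext (and_iff_left fun h => ?_)
    rw [h, normSq_eq_zero.2 rfl] at hq
    exact two_ne_zero hq.symm
  rw [drop_ne_zero, frameLaw, Measure.map_apply (hT.measurable_pair n)
      (measurableSet_le (by fun_prop) measurable_const),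
    ← (measurePreserving_fst (ν := uniformSphere k)).measure_preimage
      (measurableSet_le measurable_frobenius measurable_const).nullMeasurableSet]
  exact measure_mono fun q hq => (normSq_mulVec_le q.1 n).trans
    (mul_le_mul_of_nonneg_right hq (normSq_nonneg n))

variable [Fintype τ] [Fintype β] [Nonempty τ] [Nonempty β]

theorem exists_lintegral_rpow_neg_topDot_frameLaw_le
    (hcard : Fintype.card κ + k = Fintype.card (τ ⊕ β)) (hk : 0 < k) (hθ : 0 ≤ θ) (hθ₁ : θ < 1) :
    ∃ C : ℝ≥0∞, C < ∞ ∧ ∀ T : Matrix (τ ⊕ β) κ ℂ → Matrix (τ ⊕ β) (Fin k) ℂ, IsNullFrame T →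
      ∀ n : κ → ℂ, n ≠ 0 →
        ∫⁻ q, ENNReal.ofReal (‖topDot q.1 q.2‖ ^ 2) ^ (-θ) ∂frameLaw T n ≤
          ENNReal.ofReal (normSq n) ^ (-θ) * C := by
  classical
  obtain ⟨t⟩ := ‹Nonempty τ›
  obtain ⟨b⟩ := ‹Nonempty β›
  have htb : (Sum.inl t : τ ⊕ β) ≠ Sum.inr b := Sum.inl_ne_inr
  refine ⟨_, ENNReal.mul_lt_top (lintegral_normSq_rpow_neg_complexGaussian_lt_top hθ₁)
    (lintegral_rpow_neg_topDot_orthonormalPairLaw_lt_top htb hθ hθ₁), fun T hT n hn => ?_⟩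
  rw [(hT.isInvariantPair_frameLaw hcard n).lintegral_rpow_neg_topDot htb θ, ← mul_assoc]
  gcongr
  exact hT.lintegral_rpow_neg_frameLaw_le hk hθ hn (Sum.inl t)

theorem exists_le_frameLaw_norm_sq_topDot_lt
    (hcard : Fintype.card κ + k = Fintype.card (τ ⊕ β)) (hk : 0 < k) :
    ∃ c : ℝ≥0∞, 0 < c ∧ ∀ T : Matrix (τ ⊕ β) κ ℂ → Matrix (τ ⊕ β) (Fin k) ℂ, IsNullFrame T →
      ∀ n : κ → ℂ, n ≠ 0 → ∀ s : ℝ, 0 ≤ s → s ≤ 1 →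
        ENNReal.ofReal s * c ≤
          frameLaw T n {q | ‖topDot q.1 q.2‖ ^ 2 < s * normSq n * normSq (q.2 ∘ Sum.inr)} := by
  classical
  obtain ⟨t⟩ := ‹Nonempty τ›
  obtain ⟨b⟩ := ‹Nonempty β›
  obtain ⟨L, hL₁, hpos⟩ := exists_pos_measure_setOf_le (gaussMat (τ ⊕ β) κ) fun K =>
    ∑ i, normSq (K i)
  have : 0 < L := zero_lt_one.trans_le hL₁
  refine ⟨ENNReal.ofReal (Real.exp (-1) / L) * complexGaussian {z | 1 ≤ ‖z‖ ^ 2} ^ 2 *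
    gaussMat (τ ⊕ β) κ {K | ∑ i, normSq (K i) ≤ L}, ?_, fun T hT n hn s hs hs₁ => ?_⟩
  · exact ENNReal.mul_pos (mul_ne_zero (ENNReal.ofReal_pos.2 (by positivity)).ne'
      (pow_ne_zero 2 complexGaussian_setOf_one_le_norm_sq_pos.ne')) hpos.ne'
  have hn₀ := normSq_pos hn
  calc ENNReal.ofReal s * (ENNReal.ofReal (Real.exp (-1) / L) *
        complexGaussian {z | 1 ≤ ‖z‖ ^ 2} ^ 2 * gaussMat (τ ⊕ β) κ {K | ∑ i, normSq (K i) ≤ L})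
      = ENNReal.ofReal (Real.exp (-1) * (s * normSq n / (L * normSq n))) *
        complexGaussian {z | 1 ≤ ‖z‖ ^ 2} ^ 2 * gaussMat (τ ⊕ β) κ {K | ∑ i, normSq (K i) ≤ L} := by
        rw [← mul_assoc, ← mul_assoc, ← ENNReal.ofReal_mul hs, mul_div_mul_right _ _ hn₀.ne',
          mul_div_left_comm]
    _ ≤ ENNReal.ofReal (Real.exp (-1) * (s * normSq n / (L * normSq n))) *
        complexGaussian {z | 1 ≤ ‖z‖ ^ 2} ^ 2 *
        frameLaw T n {q | normSq q.1 ≤ L * normSq n ∧ q.2 ≠ 0} := by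
        gcongr
        exact hT.le_frameLaw_normSq_fst_le hk n L
    _ ≤ _ := (hT.isInvariantPair_frameLaw hcard n).le_norm_sq_topDot_lt
        (Sum.inl_ne_inr : (Sum.inl t : τ ⊕ β) ≠ Sum.inr b) (by positivity) (by positivity)
        (mul_le_mul_of_nonneg_right (hs₁.trans hL₁) hn₀.le)

end FrameEstimates

section PairChannel

variable {M N : ℕ} {U : Channel N M → Channel N M → Matrix (Fin N ⊕ Fin N) (Fin (2 * N - M)) ℂ}

/-- The random quantities of one pair of users: the fading matrices of the near and of the far
user, and the vector `x`. -/
abbrev PairData (M N : ℕ) : Type := Channel N M × Channel N M × (Fin (2 * N - M) → ℂ)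

/-- The joint law of the random quantities of one pair. -/
noncomputable def pairLaw (M N : ℕ) : Measure (PairData M N) :=
  (rayleigh N M).prod ((rayleigh N M).prod (uniformSphere (2 * N - M)))

instance isProbabilityMeasure_rayleigh : IsProbabilityMeasure (rayleigh N M) :=
  isProbabilityMeasure_gaussMat (ι := Fin N) (κ := Fin M)

instance isProbabilityMeasure_pairLaw : IsProbabilityMeasure (pairLaw M N) := by
  unfold pairLaw
  infer_instance

/-- The effective channel vector of one pair as a function of its random quantities. -/
def pairEff (U : Channel N M → Channel N M → Matrix (Fin N ⊕ Fin N) (Fin (2 * N - M)) ℂ)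
    (y : PairData M N) : Fin M → ℂ :=
  y.1ᴴ *ᵥ ((U y.1 y.2.1 *ᵥ y.2.2) ∘ Sum.inl)

/-- The detection vector of the far user of one pair as a function of its random quantities. -/
def pairFar (U : Channel N M → Channel N M → Matrix (Fin N ⊕ Fin N) (Fin (2 * N - M)) ℂ)
    (y : PairData M N) : Fin N → ℂ :=
  (U y.1 y.2.1 *ᵥ y.2.2) ∘ Sum.inr

theorem measurable_pairVec (hU : IsAlignment U) :
    Measurable fun y : PairData M N => U y.1 y.2.1 *ᵥ y.2.2 := by
  have h : Continuous fun p : Matrix (Fin N ⊕ Fin N) (Fin (2 * N - M)) ℂ ×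
      (Fin (2 * N - M) → ℂ) => p.1 *ᵥ p.2 := by fun_prop
  exact h.measurable.comp ((hU.measurable.comp
    (measurable_fst.prodMk (measurable_fst.comp measurable_snd))).prodMk
      (measurable_snd.comp measurable_snd))

theorem measurable_pairEff (hU : IsAlignment U) : Measurable (pairEff U) := by
  have h : Continuous fun p : Channel N M × (Fin N → ℂ) => p.1ᴴ *ᵥ p.2 := by fun_prop
  have htop : Measurable fun y : PairData M N => (U y.1 y.2.1 *ᵥ y.2.2) ∘ Sum.inl :=
    measurable_pi_lambda _ fun n => (measurable_pi_apply (Sum.inl n)).comp (measurable_pairVec hU)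
  have hcomp := h.measurable.comp ((measurable_fst (α := Channel N M)).prodMk htop)
  exact hcomp

theorem measurable_pairFar (hU : IsAlignment U) : Measurable (pairFar U) :=
  measurable_pi_lambda _ fun n => (measurable_pi_apply (Sum.inr n)).comp (measurable_pairVec hU)

/-- The frame assigned to a pair as a function of the stacked channel matrix `[A; A']`. The sign of
its lower half is reversed, so that its columns are orthogonal to those of `[A; A']`. -/
def stackFrame (U : Channel N M → Channel N M → Matrix (Fin N ⊕ Fin N) (Fin (2 * N - M)) ℂ)
    (K : Matrix (Fin N ⊕ Fin N) (Fin M) ℂ) : Matrix (Fin N ⊕ Fin N) (Fin (2 * N - M)) ℂ :=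
  Matrix.fromRows (U K.toRows₁ K.toRows₂).toRows₁ (-(U K.toRows₁ K.toRows₂).toRows₂)

theorem measurable_stackFrame (hU : IsAlignment U) : Measurable (stackFrame U) := by
  have hin : Measurable fun K : Matrix (Fin N ⊕ Fin N) (Fin M) ℂ => (K.toRows₁, K.toRows₂) := by
    refine Measurable.prodMk ?_ ?_ <;>
      exact measurable_matrix_of fun i j => (measurable_pi_apply j).comp (measurable_pi_apply _)
  have hout : Continuous fun V : Matrix (Fin N ⊕ Fin N) (Fin (2 * N - M)) ℂ =>
      Matrix.fromRows V.toRows₁ (-V.toRows₂) :=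
    continuous_matrix fun i j => by
      cases i
      · exact continuous_apply_apply _ j
      · exact (continuous_apply_apply _ j).neg
  exact hout.measurable.comp (hU.measurable.comp hin)

theorem isNullFrame_stackFrame (hU : IsAlignment U) : IsNullFrame (stackFrame U) where
  measurable := measurable_stackFrame hU
  orthonormal K := by
    rw [← hU.orthonormal K.toRows₁ K.toRows₂]
    ext i j
    simp [Matrix.mul_apply, Fintype.sum_sum_type, stackFrame]
  null K := by
    rw [← hU.null K.toRows₁ K.toRows₂]
    ext i j
    simp [Matrix.mul_apply, Fintype.sum_sum_type, stackFrame]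

theorem measurePreserving_fromRows : MeasurePreserving
    (fun y : PairData M N => (Matrix.fromRows y.1 y.2.1, y.2.2)) (pairLaw M N)
    ((gaussMat (Fin N ⊕ Fin N) (Fin M)).prod (uniformSphere (2 * N - M))) := by
  have hrows : MeasurePreserving (fun p : Channel N M × Channel N M => Matrix.fromRows p.1 p.2)
      ((rayleigh N M).prod (rayleigh N M)) (gaussMat (Fin N ⊕ Fin N) (Fin M)) := by
    have hsum : ⇑(MeasurableEquiv.sumPiEquivProdPi fun _ : Fin N ⊕ Fin N => Fin M → ℂ).symm =
        fun p => Matrix.fromRows (Matrix.of p.1) (Matrix.of p.2) := by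
      ext p i j
      cases i <;> rfl
    exact hsum ▸ measurePreserving_sumPiEquivProdPi_symm
      fun _ : Fin N ⊕ Fin N => Measure.pi fun _ : Fin M => complexGaussian
  have : SFinite (uniformSphere (2 * N - M)) := inferInstance
  exact (hrows.prod (MeasurePreserving.id _)).comp
    (measurePreserving_prodAssoc (rayleigh N M) (rayleigh N M) (uniformSphere (2 * N - M))).symm

theorem topDot_stackFrame (c : Fin M → ℂ) (y : PairData M N) :
    topDot (Matrix.fromRows y.1 y.2.1 *ᵥ star c)
      (stackFrame U (Matrix.fromRows y.1 y.2.1) *ᵥ y.2.2) = c ⬝ᵥ pairEff U y := by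
  rw [pairEff, Matrix.dotProduct_mulVec, ← star_star (c ᵥ* y.1ᴴ), Matrix.star_vecMul,
    Matrix.conjTranspose_conjTranspose]
  simp [topDot, dotProduct, stackFrame, Matrix.mulVec]

theorem normSq_stackFrame_comp_inr (y : PairData M N) :
    normSq ((stackFrame U (Matrix.fromRows y.1 y.2.1) *ᵥ y.2.2) ∘ Sum.inr) =
      normSq (pairFar U y) := by
  simp [normSq, stackFrame, pairFar, Matrix.mulVec, dotProduct]

theorem measurePreserving_frameLaw_stackFrame (hU : IsAlignment U) (c : Fin M → ℂ) :
    MeasurePreserving (fun y : PairData M N => (Matrix.fromRows y.1 y.2.1 *ᵥ star c,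
      stackFrame U (Matrix.fromRows y.1 y.2.1) *ᵥ y.2.2)) (pairLaw M N)
      (frameLaw (stackFrame U) (star c)) :=
  MeasurePreserving.comp ⟨(isNullFrame_stackFrame hU).measurable_pair _, rfl⟩
    measurePreserving_fromRows

theorem exists_lintegral_rpow_neg_pairEff_le (hMN : M < 2 * N) {θ : ℝ} (hθ : 0 ≤ θ)
    (hθ₁ : θ < 1) :
    ∃ C : ℝ≥0∞, C < ∞ ∧
      ∀ U : Channel N M → Channel N M → Matrix (Fin N ⊕ Fin N) (Fin (2 * N - M)) ℂ,
      IsAlignment U → ∀ c : Fin M → ℂ, c ≠ 0 →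
        ∫⁻ y, ENNReal.ofReal (‖c ⬝ᵥ pairEff U y‖ ^ 2) ^ (-θ) ∂pairLaw M N ≤
          ENNReal.ofReal (normSq c) ^ (-θ) * C := by
  have : Nonempty (Fin N) := ⟨⟨0, by lia⟩⟩
  obtain ⟨C, hC, h⟩ := exists_lintegral_rpow_neg_topDot_frameLaw_le (τ := Fin N) (β := Fin N)
    (κ := Fin M) (k := 2 * N - M) (by simp; lia) (by lia) hθ hθ₁
  refine ⟨C, hC, fun U hU c hc => ?_⟩
  have h' := h _ (isNullFrame_stackFrame hU) (star c) (star_ne_zero.2 hc)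
  rw [normSq_star, ← (measurePreserving_frameLaw_stackFrame hU c).lintegral_comp
    (measurable_rpow_neg_topDot θ)] at h'
  simpa only [topDot_stackFrame] using h'

theorem exists_le_pairLaw_norm_sq_dotProduct_lt (hMN : M < 2 * N) :
    ∃ δ : ℝ≥0∞, 0 < δ ∧
      ∀ U : Channel N M → Channel N M → Matrix (Fin N ⊕ Fin N) (Fin (2 * N - M)) ℂ,
      IsAlignment U → ∀ c : Fin M → ℂ, c ≠ 0 → ∀ s : ℝ, 0 ≤ s → s ≤ 1 →
        ENNReal.ofReal s * δ ≤
          pairLaw M N {y | ‖c ⬝ᵥ pairEff U y‖ ^ 2 < s * normSq c * normSq (pairFar U y)} := by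
  have : Nonempty (Fin N) := ⟨⟨0, by lia⟩⟩
  obtain ⟨δ, hδ, h⟩ := exists_le_frameLaw_norm_sq_topDot_lt (τ := Fin N) (β := Fin N)
    (κ := Fin M) (k := 2 * N - M) (by simp; lia) (by lia)
  refine ⟨δ, hδ, fun U hU c hc s hs hs₁ => ?_⟩
  have h' := h _ (isNullFrame_stackFrame hU) (star c) (star_ne_zero.2 hc) s hs hs₁
  rw [← (measurePreserving_frameLaw_stackFrame hU c).measure_preimage
    (measurableSet_norm_sq_topDot_lt_normSq_comp_inr _).nullMeasurableSet] at h'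
  simpa only [Set.preimage_ofPred_eq, topDot_stackFrame, normSq_stackFrame_comp_inr,
    normSq_star] using h'

theorem measurable_rpow_neg_dotProduct_pairEff (hU : IsAlignment U) (c : Fin M → ℂ) (θ : ℝ) :
    Measurable fun y => ENNReal.ofReal (‖c ⬝ᵥ pairEff U y‖ ^ 2) ^ (-θ) := by
  have : Measurable fun z : Fin M → ℂ => ENNReal.ofReal (‖c ⬝ᵥ z‖ ^ 2) ^ (-θ) := by
    unfold dotProduct
    fun_prop
  exact this.comp (measurable_pairEff hU)

theorem ae_dotProduct_pairEff_ne_zero (hMN : M < 2 * N) (hU : IsAlignment U) {c : Fin M → ℂ}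
    (hc : c ≠ 0) : ∀ᵐ y ∂pairLaw M N, c ⬝ᵥ pairEff U y ≠ 0 := by
  obtain ⟨C, hC, h⟩ := exists_lintegral_rpow_neg_pairEff_le (M := M) hMN (θ := 1 / 2)
    (by norm_num) (by norm_num)
  have hfin : ∫⁻ y, ENNReal.ofReal (‖c ⬝ᵥ pairEff U y‖ ^ 2) ^ (-(1 / 2) : ℝ) ∂pairLaw M N ≠ ∞ :=
    ((h U hU c hc).trans_lt (ENNReal.mul_lt_top (ENNReal.rpow_ne_top_of_ne_zero
      (ENNReal.ofReal_pos.2 (normSq_pos hc)).ne' ENNReal.ofReal_ne_top).lt_top hC)).ne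
  filter_upwards [ae_lt_top (measurable_rpow_neg_dotProduct_pairEff hU c (1 / 2)) hfin] with y hy h₀
  simp [h₀] at hy

theorem normSq_pairFar_le (hU : IsAlignment U) (y : PairData M N) :
    normSq (pairFar U y) ≤ normSq y.2.2 := by
  rw [← normSq_mulVec (hU.orthonormal y.1 y.2.1) y.2.2, normSq, normSq, Fintype.sum_sum_type]
  exact le_add_of_nonneg_left (Finset.sum_nonneg fun i _ => sq_nonneg _)

theorem pairEff_eq_zero_of_pairFar_eq_zero (hU : IsAlignment U) {y : PairData M N}
    (h : pairFar U y = 0) : pairEff U y = 0 := by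
  have hnull : Matrix.fromCols y.1ᴴ (-y.2.1ᴴ) *ᵥ (U y.1 y.2.1 *ᵥ y.2.2) = 0 := by
    rw [Matrix.mulVec_mulVec, hU.null, Matrix.zero_mulVec]
  rw [pairFar] at h
  rwa [Matrix.fromCols_mulVec, h, Matrix.mulVec_zero, add_zero] at hnull

end PairChannel

section ZeroForcing

variable {M N : ℕ} {U : Fin M → Channel N M → Channel N M →
  Matrix (Fin N ⊕ Fin N) (Fin (2 * N - M)) ℂ}

/-- The effective channel matrix as a function of the data of all pairs. -/
def pairsMatrix
    (U : Fin M → Channel N M → Channel N M → Matrix (Fin N ⊕ Fin N) (Fin (2 * N - M)) ℂ)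
    (y : Fin M → PairData M N) : Matrix (Fin M) (Fin M) ℂ :=
  Matrix.of fun j i => pairEff (U i) (y i) j

/-- The zero-forcing gain `1 / (G⁻¹ G⁻ᴴ)_{m,m}` as a function of the data of all pairs, expanded by
Cramer's rule so that it is also defined (and zero) for a singular effective channel matrix. -/
noncomputable def zfGain
    (U : Fin M → Channel N M → Channel N M → Matrix (Fin N ⊕ Fin N) (Fin (2 * N - M)) ℂ)
    (m : Fin M) (y : Fin M → PairData M N) : ℝ :=
  ‖(pairsMatrix U y).det‖ ^ 2 / normSq ((pairsMatrix U y).adjugate m)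

theorem zfDiag_eq_inv_zfGain (G G' : Fin M → Channel N M) (x : Fin M → Fin (2 * N - M) → ℂ)
    (m : Fin M) : zfDiag U G G' x m = (zfGain U m fun i => (G i, G' i, x i))⁻¹ := by
  rw [zfGain, inv_div]
  exact inv_mul_inv_conjTranspose_diag_re _ m

theorem zfGain_nonneg (m : Fin M) (y : Fin M → PairData M N) : 0 ≤ zfGain U m y :=
  div_nonneg (sq_nonneg _) (normSq_nonneg _)

theorem pairsMatrix_update (m : Fin M) (y : Fin M → PairData M N) (t : PairData M N) :
    pairsMatrix U (Function.update y m t) = (pairsMatrix U y).updateCol m (pairEff (U m) t) := by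
  ext j i
  obtain rfl | hi := eq_or_ne i m
  · simp [pairsMatrix]
  · simp [pairsMatrix, hi]

theorem zfGain_update (m : Fin M) (y : Fin M → PairData M N) (t : PairData M N) :
    zfGain U m (Function.update y m t) =
      ‖(pairsMatrix U y).adjugate m ⬝ᵥ pairEff (U m) t‖ ^ 2 /
        normSq ((pairsMatrix U y).adjugate m) := by
  rw [zfGain, pairsMatrix_update, adjugate_updateCol_self, det_updateCol_eq_adjugate_dotProduct]

theorem measurable_pairsMatrix (hU : ∀ i, IsAlignment (U i)) : Measurable (pairsMatrix U) :=
  measurable_matrix_of fun j i =>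
    (measurable_pi_apply j).comp ((measurable_pairEff (hU i)).comp (measurable_pi_apply i))

theorem measurable_zfGain (hU : ∀ i, IsAlignment (U i)) (m : Fin M) : Measurable (zfGain U m) := by
  have hadj : Continuous fun A : Matrix (Fin M) (Fin M) ℂ => A.adjugate m :=
    (continuous_apply m).comp continuous_id.matrix_adjugate
  exact ((measurable_det.comp (measurable_pairsMatrix hU)).norm.pow_const 2).div
    ((measurable_normSq.comp hadj.measurable).comp (measurable_pairsMatrix hU))

theorem ae_det_pairsMatrix_ne_zero (hMN : M < 2 * N) (hU : ∀ i, IsAlignment (U i)) :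
    ∀ᵐ y ∂Measure.pi fun _ : Fin M => pairLaw M N, (pairsMatrix U y).det ≠ 0 :=
  ae_det_ne_zero (fun _ : Fin M => pairLaw M N) (fun i => measurable_pairEff (hU i))
    fun i _ hc => ae_dotProduct_pairEff_ne_zero hMN (hU i) hc

theorem pairFar_ne_zero_of_det_ne_zero (hU : ∀ i, IsAlignment (U i)) {y : Fin M → PairData M N}
    (h : (pairsMatrix U y).det ≠ 0) (m : Fin M) : pairFar (U m) (y m) ≠ 0 := fun h₀ =>
  h (Matrix.det_eq_zero_of_column_eq_zero m fun j =>
    congrFun (pairEff_eq_zero_of_pairFar_eq_zero (hU m) h₀) j)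

theorem exists_lintegral_rpow_neg_zfGain_update_le (hMN : M < 2 * N)
    (hU : ∀ i, IsAlignment (U i)) (m : Fin M) {θ : ℝ} (hθ : 0 ≤ θ) (hθ₁ : θ < 1) :
    ∃ C : ℝ≥0∞, C < ∞ ∧ ∀ y, (pairsMatrix U y).adjugate m ≠ 0 →
      ∫⁻ t, ENNReal.ofReal (zfGain U m (Function.update y m t)) ^ (-θ) ∂pairLaw M N ≤ C := by
  obtain ⟨C, hC, h⟩ := exists_lintegral_rpow_neg_pairEff_le hMN hθ hθ₁
  refine ⟨C, hC, fun y hc => ?_⟩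
  set c := (pairsMatrix U y).adjugate m with hcy
  have hn : 0 < ENNReal.ofReal (normSq c) := ENNReal.ofReal_pos.2 (normSq_pos hc)
  calc ∫⁻ t, ENNReal.ofReal (zfGain U m (Function.update y m t)) ^ (-θ) ∂pairLaw M N
      = ∫⁻ t, ENNReal.ofReal (normSq c) ^ θ *
        ENNReal.ofReal (‖c ⬝ᵥ pairEff (U m) t‖ ^ 2) ^ (-θ) ∂pairLaw M N := by
        refine lintegral_congr fun t => ?_
        rw [zfGain_update, ← hcy, ENNReal.ofReal_div_of_pos (normSq_pos hc), ENNReal.rpow_neg,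
          ENNReal.div_rpow_of_nonneg _ _ hθ, ENNReal.inv_div
            (.inl (ENNReal.rpow_ne_top_of_nonneg hθ ENNReal.ofReal_ne_top))
            (.inl (ENNReal.rpow_pos hn ENNReal.ofReal_ne_top).ne'), ENNReal.rpow_neg,
          div_eq_mul_inv]
    _ = ENNReal.ofReal (normSq c) ^ θ *
        ∫⁻ t, ENNReal.ofReal (‖c ⬝ᵥ pairEff (U m) t‖ ^ 2) ^ (-θ) ∂pairLaw M N :=
        lintegral_const_mul _ (measurable_rpow_neg_dotProduct_pairEff (hU m) c θ)
    _ ≤ ENNReal.ofReal (normSq c) ^ θ * (ENNReal.ofReal (normSq c) ^ (-θ) * C) := by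
        gcongr
        exact h (U m) (hU m) c hc
    _ = C := by
        rw [← mul_assoc, ← ENNReal.rpow_add _ _ hn.ne' ENNReal.ofReal_ne_top, add_neg_cancel,
          ENNReal.rpow_zero, one_mul]

theorem lintegral_rpow_neg_zfGain_lt_top (hMN : M < 2 * N) (hU : ∀ i, IsAlignment (U i))
    (m : Fin M) {θ : ℝ} (hθ : 0 ≤ θ) (hθ₁ : θ < 1) :
    ∫⁻ y, ENNReal.ofReal (zfGain U m y) ^ (-θ) ∂(Measure.pi fun _ : Fin M => pairLaw M N) < ∞ := by
  obtain ⟨C, hC, h⟩ := exists_lintegral_rpow_neg_zfGain_update_le hMN hU m hθ hθ₁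
  have hmeas : Measurable fun y : Fin M → PairData M N => ENNReal.ofReal (zfGain U m y) ^ (-θ) :=
    (measurable_zfGain hU m).ennreal_ofReal.pow_const _
  have hup := measurePreserving_update (fun _ : Fin M => pairLaw M N) m
  rw [← hup.lintegral_comp hmeas, lintegral_prod
    (fun p : (Fin M → PairData M N) × PairData M N =>
      ENNReal.ofReal (zfGain U m (Function.update p.1 m p.2)) ^ (-θ))
    (hmeas.comp hup.measurable).aemeasurable]
  refine lt_of_le_of_lt (b := ∫⁻ _, C ∂(Measure.pi fun _ : Fin M => pairLaw M N))
    (lintegral_mono_ae ?_) (by rwa [lintegral_const, measure_univ, mul_one])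
  filter_upwards [ae_det_pairsMatrix_ne_zero hMN hU] with y hy
  exact h y (adjugate_ne_zero_of_det_ne_zero hy m)

theorem measurableSet_zfGain_lt (hU : ∀ i, IsAlignment (U i)) (m : Fin M) (s : ℝ) :
    MeasurableSet {y | zfGain U m y < s * normSq (pairFar (U m) (y m))} :=
  measurableSet_lt (measurable_zfGain hU m) ((measurable_normSq.comp
    ((measurable_pairFar (hU m)).comp (measurable_pi_apply m))).const_mul s)

theorem exists_le_zfGain_lt (hMN : M < 2 * N) (hU : ∀ i, IsAlignment (U i)) (m : Fin M) :
    ∃ δ : ℝ≥0∞, 0 < δ ∧ ∀ s : ℝ, 0 ≤ s → s ≤ 1 →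
      ENNReal.ofReal s * δ ≤ (Measure.pi fun _ : Fin M => pairLaw M N)
        {y | zfGain U m y < s * normSq (pairFar (U m) (y m))} := by
  obtain ⟨δ, hδ, h⟩ := exists_le_pairLaw_norm_sq_dotProduct_lt hMN
  refine ⟨δ, hδ, fun s hs hs₁ => ?_⟩
  have hup := measurePreserving_update (fun _ : Fin M => pairLaw M N) m
  have hset := measurableSet_zfGain_lt hU m s
  rw [← hup.measure_preimage hset.nullMeasurableSet, Measure.prod_apply (hup.measurable hset)]
  calc ENNReal.ofReal s * δ
      = ∫⁻ _, ENNReal.ofReal s * δ ∂(Measure.pi fun _ : Fin M => pairLaw M N) := by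
        rw [lintegral_const, measure_univ, mul_one]
    _ ≤ _ := lintegral_mono_ae ?_
  filter_upwards [ae_det_pairsMatrix_ne_zero hMN hU] with y hy
  have hc := adjugate_ne_zero_of_det_ne_zero hy m
  refine (h (U m) (hU m) _ hc s hs hs₁).trans (measure_mono fun t ht => ?_)
  have hlt : zfGain U m (Function.update y m t) < s * normSq (pairFar (U m) t) := by
    rw [zfGain_update, div_lt_iff₀ (normSq_pos hc), mul_right_comm]
    exact ht
  simpa using hlt

end ZeroForcing

section Interference

theorem lintegral_natCast_poissonMeasure (r : ℝ≥0) :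
    ∫⁻ n : ℕ, (n : ℝ≥0∞) ∂poissonMeasure r = r := by
  have hstep (n : ℕ) : ((n + 1 : ℕ) : ℝ≥0∞) * poissonMeasure r {n + 1} =
      r * poissonMeasure r {n} := by
    rw [poissonMeasure_singleton, poissonMeasure_singleton, ← ENNReal.ofReal_natCast,
      ← ENNReal.ofReal_mul (by positivity), ← ENNReal.ofReal_coe_nnreal,
      ← ENNReal.ofReal_mul (by positivity), Nat.factorial_succ]
    congr 1
    push_cast
    field_simp
    ring
  have htotal : ∑' n : ℕ, poissonMeasure r {n} = 1 := by
    simpa using (lintegral_countable' (μ := poissonMeasure r) fun _ => 1).symm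
  rw [lintegral_countable', tsum_eq_zero_add' ENNReal.summable]
  simp only [hstep, ENNReal.tsum_mul_left, htotal, Nat.cast_zero, zero_mul, zero_add, mul_one]

variable {Ω : Type*} [MeasurableSpace Ω] {μ : Measure Ω} {lam : ℝ≥0} {Ψ : Ω → Set Plane}

theorem IsPoissonProcess.lintegral_count (h : IsPoissonProcess μ lam Ψ) {B : Set Plane}
    (hB : MeasurableSet B) (hfin : volume B ≠ ∞) :
    ∫⁻ ω, points (Ψ ω) B ∂μ = lam * volume B := by
  have hlaw := (h.count_law B hB hfin).lintegral_comp (f := id) measurable_id.aemeasurable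
  simp only [id_eq] at hlaw
  rw [hlaw, lintegral_map measurable_id' .of_discrete, lintegral_natCast_poissonMeasure,
    ENNReal.coe_mul, ENNReal.coe_toNNReal hfin]

theorem IsPoissonProcess.join_map_points (h : IsPoissonProcess μ lam Ψ) :
    (μ.map fun ω => points (Ψ ω)).join = lam • (volume : Measure Plane) := by
  have hfin {B : Set Plane} (hB : MeasurableSet B) (hv : volume B ≠ ∞) :
      (μ.map fun ω => points (Ψ ω)).join B = (lam • (volume : Measure Plane)) B := by
    rw [Measure.join_apply hB, lintegral_map (Measure.measurable_coe hB) h.measurable,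
      h.lintegral_count hB hv]
    rfl
  refine (Measure.ext_iff_of_iUnion_eq_univ
    (iUnion_spanningSets (volume : Measure Plane))).2 fun n => ?_
  ext B hB
  rw [Measure.restrict_apply hB, Measure.restrict_apply hB]
  refine hfin (hB.inter (measurableSet_spanningSets _ n)) (ne_top_of_le_ne_top ?_
    (measure_mono Set.inter_subset_right))
  exact (measure_spanningSets_lt_top _ n).ne

/-- **Campbell's formula**. -/
theorem IsPoissonProcess.lintegral_lintegral (h : IsPoissonProcess μ lam Ψ) {f : Plane → ℝ≥0∞}
    (hf : Measurable f) :
    ∫⁻ ω, ∫⁻ y, f y ∂points (Ψ ω) ∂μ = lam * ∫⁻ y, f y := by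
  have hjoin := Measure.lintegral_join (m := μ.map fun ω => points (Ψ ω)) hf.aemeasurable
  rw [h.join_map_points, lintegral_map (Measure.measurable_lintegral hf) h.measurable] at hjoin
  rw [← hjoin]
  exact lintegral_smul_measure _ _

variable {r₀ α : ℝ}

theorem pathLoss_eq_max_rpow (r₀ α d : ℝ) : pathLoss r₀ α d = max r₀ d ^ α := by
  unfold pathLoss
  split_ifs with h
  · rw [max_eq_right h.le]
  · rw [max_eq_left (not_lt.1 h)]

theorem pathLoss_pos (hr₀ : 0 < r₀) (d : ℝ) : 0 < pathLoss r₀ α d := by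
  rw [pathLoss_eq_max_rpow]
  exact Real.rpow_pos_of_pos (lt_max_of_lt_left hr₀) _

theorem pathLoss_mono (hr₀ : 0 < r₀) (hα : 0 ≤ α) : Monotone (pathLoss r₀ α) := fun d d' h => by
  rw [pathLoss_eq_max_rpow, pathLoss_eq_max_rpow]
  exact Real.rpow_le_rpow (hr₀.le.trans (le_max_left _ _)) (max_le_max_left _ h) hα

theorem pathLoss_anti (hr₀ : 0 < r₀) (hα : α ≤ 0) : Antitone (pathLoss r₀ α) := fun d d' h => by
  rw [pathLoss_eq_max_rpow, pathLoss_eq_max_rpow]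
  exact Real.rpow_le_rpow_of_nonpos (lt_max_of_lt_left hr₀) (max_le_max_left _ h) hα

theorem exists_pathLoss_mem_Icc (hr₀ : 0 < r₀) (α r : ℝ) :
    ∃ ℓ L : ℝ, 0 < ℓ ∧ 0 < L ∧ ∀ d ∈ Set.Icc 0 r, pathLoss r₀ α d ∈ Set.Icc ℓ L := by
  rcases le_total 0 α with hα | hα
  · exact ⟨pathLoss r₀ α 0, pathLoss r₀ α r, pathLoss_pos hr₀ 0, pathLoss_pos hr₀ r,
      fun d hd => ⟨pathLoss_mono hr₀ hα hd.1, pathLoss_mono hr₀ hα hd.2⟩⟩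
  · exact ⟨pathLoss r₀ α r, pathLoss r₀ α 0, pathLoss_pos hr₀ r, pathLoss_pos hr₀ 0,
      fun d hd => ⟨pathLoss_anti hr₀ hα hd.2, pathLoss_anti hr₀ hα hd.1⟩⟩

theorem measurable_pathLoss : Measurable (pathLoss r₀ α) :=
  Measurable.ite measurableSet_Ioi (by fun_prop) measurable_const

theorem interference_eq_lintegral (r₀ α ρI : ℝ) (S : Set Plane) (p : Plane) :
    interference r₀ α ρI S p =
      ∫⁻ y, ENNReal.ofReal (ρI / pathLoss r₀ α (dist p y)) ∂points S := by
  simp only [points, lintegral_sum_measure, interference, lintegral_dirac]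

/-- The largest contribution that an interferer at `y` can make to the interference at a point of
the disc of radius `r`. -/
noncomputable def interferenceBound (r₀ α ρI r : ℝ) (y : Plane) : ℝ≥0∞ :=
  ENNReal.ofReal (ρI / pathLoss r₀ α (‖y‖ - r))

theorem measurable_interferenceBound (r₀ α ρI r : ℝ) :
    Measurable (interferenceBound r₀ α ρI r) :=
  ((measurable_pathLoss.comp (measurable_norm.sub_const r)).const_div ρI).ennreal_ofReal

theorem interference_le (hr₀ : 0 < r₀) (hα : 0 ≤ α) {ρI : ℝ} (hρI : 0 ≤ ρI) (S : Set Plane)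
    {p : Plane} {r : ℝ} (hp : ‖p‖ ≤ r) :
    interference r₀ α ρI S p ≤ ∫⁻ y, interferenceBound r₀ α ρI r y ∂points S := by
  rw [interference_eq_lintegral]
  refine lintegral_mono fun y => ENNReal.ofReal_le_ofReal
    (div_le_div_of_nonneg_left hρI (pathLoss_pos hr₀ _) (pathLoss_mono hr₀ hα ?_))
  have hy := norm_sub_norm_le y p
  rw [dist_comm, dist_eq_norm]
  linarith

theorem exists_mul_one_add_rpow_le_pathLoss (hr₀ : 0 < r₀) (hα : 0 ≤ α) (r : ℝ) :
    ∃ c : ℝ, 0 < c ∧ ∀ x : ℝ, 0 ≤ x → c * (1 + x) ^ α ≤ pathLoss r₀ α (x - r) := by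
  set C : ℝ := (1 + |r|) / r₀ + 1 with hC
  have hCpos : 0 < C := by positivity
  refine ⟨C⁻¹ ^ α, by positivity, fun x hx => ?_⟩
  rw [pathLoss_eq_max_rpow, ← Real.mul_rpow (by positivity) (by positivity)]
  refine Real.rpow_le_rpow (by positivity) ?_ hα
  have hscale : (1 + |r|) / r₀ * r₀ ≤ (1 + |r|) / r₀ * max r₀ (x - r) := by
    gcongr
    exact le_max_left _ _
  rw [div_mul_cancel₀ _ hr₀.ne'] at hscale
  rw [inv_mul_le_iff₀ hCpos, hC]
  linarith [le_max_right r₀ (x - r), le_abs_self r]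

theorem lintegral_interferenceBound_lt_top (hr₀ : 0 < r₀) (hα : 2 < α) {ρI : ℝ} (hρI : 0 ≤ ρI)
    (r : ℝ) : ∫⁻ y, interferenceBound r₀ α ρI r y < ∞ := by
  obtain ⟨c, hc, hle⟩ := exists_mul_one_add_rpow_le_pathLoss hr₀ (by linarith : 0 ≤ α) r
  have hint : Integrable (fun y : Plane => (1 + ‖y‖) ^ (-α)) :=
    integrable_one_add_norm (by simpa using hα)
  refine lt_of_le_of_lt (lintegral_mono fun y => ENNReal.ofReal_le_ofReal ?_)
    (hint.const_mul (ρI / c)).lintegral_lt_top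
  have hy : 0 < 1 + ‖y‖ := by positivity
  calc ρI / pathLoss r₀ α (‖y‖ - r) ≤ ρI / (c * (1 + ‖y‖) ^ α) := by
        gcongr
        exact hle _ (norm_nonneg y)
    _ = ρI / c * (1 + ‖y‖) ^ (-α) := by rw [Real.rpow_neg hy.le]; field_simp

theorem IsPoissonProcess.exists_interference_le (h : IsPoissonProcess μ lam Ψ) (hr₀ : 0 < r₀)
    {ρI : ℝ} (hρI : 0 ≤ ρI) (hα : 0 < ρI → 2 < α) (r : ℝ) :
    ∃ J : Measure Plane → ℝ≥0∞, Measurable J ∧ ∫⁻ ω, J (points (Ψ ω)) ∂μ < ∞ ∧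
      ∀ S p, ‖p‖ ≤ r → interference r₀ α ρI S p ≤ J (points S) := by
  rcases hρI.eq_or_lt with rfl | hpos
  · exact ⟨0, measurable_zero, by simp, fun S p _ => by simp [interference]⟩
  · have hJ := measurable_interferenceBound r₀ α ρI r
    refine ⟨fun ν => ∫⁻ y, interferenceBound r₀ α ρI r y ∂ν, Measure.measurable_lintegral hJ, ?_,
      fun S p hp => interference_le hr₀ (by linarith [hα hpos]) hρI S hp⟩
    rw [h.lintegral_lintegral hJ]
    exact ENNReal.mul_lt_top ENNReal.coe_lt_top
      (lintegral_interferenceBound_lt_top hr₀ (hα hpos) hρI r)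

end Interference

section Diversity

theorem tendsto_neg_log_mul_rpow_div_log {c : ℝ} (hc : 0 < c) (t : ℝ) :
    Tendsto (fun ρ => -Real.log (c * ρ ^ (-t)) / Real.log ρ) atTop (𝓝 t) := by
  have hlim : Tendsto (fun ρ => t - Real.log c / Real.log ρ) atTop (𝓝 t) := by
    simpa using tendsto_const_nhds.sub
      ((tendsto_const_nhds (x := Real.log c)).div_atTop Real.tendsto_log_atTop)
  refine hlim.congr' ?_
  filter_upwards [eventually_gt_atTop 1] with ρ hρ
  have hρ₀ : 0 < ρ := one_pos.trans hρ
  rw [Real.log_mul hc.ne' (Real.rpow_pos_of_pos hρ₀ _).ne', Real.log_rpow hρ₀]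
  field_simp [(Real.log_pos hρ).ne']
  ring

theorem neg_log_div_log_le_of_le {ρ p q : ℝ} (hρ : 1 < ρ) (hp : 0 < p) (hpq : p ≤ q) :
    -Real.log q / Real.log ρ ≤ -Real.log p / Real.log ρ :=
  div_le_div_of_nonneg_right (neg_le_neg (Real.log_le_log hp hpq)) (Real.log_pos hρ).le

theorem hasDiversityOrder_of_bounds {P : ℝ → ℝ} {c d : ℝ} (hc : 0 < c)
    (hlow : ∀ᶠ ρ in atTop, c * ρ ^ (-d) ≤ P ρ)
    (hup : ∀ᶠ θ in 𝓝[<] d, ∃ C : ℝ, ∀ᶠ ρ in atTop, P ρ ≤ C * ρ ^ (-θ)) :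
    HasDiversityOrder P d := by
  have hpos : ∀ᶠ ρ in atTop, 0 < P ρ := by
    filter_upwards [hlow, eventually_gt_atTop 0] with ρ hle hρ
    exact (mul_pos hc (Real.rpow_pos_of_pos hρ _)).trans_le hle
  refine ⟨hpos, tendsto_order.2 ⟨fun b hb => ?_, fun b hb => ?_⟩⟩
  · obtain ⟨θ, ⟨C, hC⟩, hbθ⟩ :=
      (hup.and ((eventually_gt_nhds hb).filter_mono nhdsWithin_le_nhds)).exists
    have hmax : 0 < max C 1 := lt_max_of_lt_right one_pos
    filter_upwards [(tendsto_order.1 (tendsto_neg_log_mul_rpow_div_log hmax θ)).1 b hbθ, hpos, hC,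
      eventually_gt_atTop 1] with ρ hb' hP hPC hρ
    refine hb'.trans_le (neg_log_div_log_le_of_le hρ hP (hPC.trans ?_))
    exact mul_le_mul_of_nonneg_right (le_max_left C 1) (by positivity)
  · filter_upwards [(tendsto_order.1 (tendsto_neg_log_mul_rpow_div_log hc d)).2 b hb, hlow,
      eventually_gt_atTop 1] with ρ hb' hle hρ
    exact (neg_log_div_log_le_of_le hρ (by positivity) hle).trans_lt hb'

variable {r₀ α a a' R ρ h w g d : ℝ}

theorem logb_one_add_sinr_lt_iff (hρ : 0 ≤ ρ) (hw : 0 < w) :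
    Real.logb 2 (1 + sinr a a' ρ h w) < R ↔
      ρ * |h| ^ 2 * (a' ^ 2 - a ^ 2 * (2 ^ R - 1)) < (2 ^ R - 1) * w := by
  have hden : 0 < ρ * |h| ^ 2 * a ^ 2 + w := by positivity
  have hsinr : 0 ≤ sinr a a' ρ h w := div_nonneg (by positivity) hden.le
  rw [Real.logb_lt_iff_lt_rpow one_lt_two (by positivity), ← lt_sub_iff_add_lt', sinr,
    div_lt_iff₀ hden, ← sub_pos, ← sub_pos (a := (2 ^ R - 1) * w)]
  ring_nf

theorem abs_scalarGain_inv_sq (hr₀ : 0 < r₀) (hg : 0 ≤ g) :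
    |scalarGain r₀ α d g⁻¹| ^ 2 = g / pathLoss r₀ α d := by
  rw [sq_abs, scalarGain, div_pow, one_pow,
    Real.sq_sqrt (mul_nonneg (pathLoss_pos hr₀ d).le (inv_nonneg.2 hg)), one_div, mul_inv, inv_inv,
    div_eq_inv_mul]

theorem exists_outage_thresholds (hr₀ : 0 < r₀) (hR : 0 < R)
    (hcond : a ^ 2 * (2 ^ R - 1) < a' ^ 2) (α r : ℝ) :
    ∃ κ K : ℝ, 0 < κ ∧ 0 < K ∧ ∀ d ∈ Set.Icc 0 r, ∀ ρ g w, 0 ≤ ρ → 0 ≤ g → 0 < w →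
      (ρ * g < κ * w → Real.logb 2 (1 + sinr a a' ρ (scalarGain r₀ α d g⁻¹) w) < R) ∧
      (Real.logb 2 (1 + sinr a a' ρ (scalarGain r₀ α d g⁻¹) w) < R → ρ * g < K * w) := by
  obtain ⟨ℓ, L, hℓ, hL, hloss⟩ := exists_pathLoss_mem_Icc hr₀ α r
  have hε : 0 < (2 : ℝ) ^ R - 1 := sub_pos.2 (Real.one_lt_rpow one_lt_two hR)
  have hgap : 0 < a' ^ 2 - a ^ 2 * (2 ^ R - 1) := sub_pos.2 hcond
  set ε : ℝ := 2 ^ R - 1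
  set η := a' ^ 2 - a ^ 2 * ε
  refine ⟨ε * ℓ / η, ε * L / η, by positivity, by positivity, fun d hd ρ g w hρ hg hw => ?_⟩
  have hpl := pathLoss_pos (α := α) hr₀ d
  have houtage : Real.logb 2 (1 + sinr a a' ρ (scalarGain r₀ α d g⁻¹) w) < R ↔
      ρ * g < ε * pathLoss r₀ α d / η * w := by
    rw [logb_one_add_sinr_lt_iff hρ hw, abs_scalarGain_inv_sq hr₀ hg, ← mul_div_assoc,
      div_mul_eq_mul_div, div_lt_iff₀ hpl, div_mul_eq_mul_div, lt_div_iff₀ hgap]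
    exact iff_of_eq (congrArg _ (by ring))
  rw [houtage]
  refine ⟨fun hlt => hlt.trans_le ?_, fun hlt => hlt.trans_le ?_⟩
  · gcongr
    exact (hloss d hd).1
  · gcongr
    exact (hloss d hd).2

theorem measure_le_mul_le_rpow_mul_lintegral {Ω : Type*} [MeasurableSpace Ω] {μ : Measure Ω}
    {X W : Ω → ℝ≥0∞} (hX : AEMeasurable X μ) (hW : AEMeasurable W μ) (hind : IndepFun X W μ)
    (hfin : ∀ᵐ ω ∂μ, X ω ≠ ∞) (hone : ∀ ω, 1 ≤ W ω) {θ : ℝ} (hθ : 0 < θ) (hθ₁ : θ ≤ 1)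
    {t : ℝ≥0∞} (ht : t ≠ 0) :
    μ {ω | X ω ≤ t * W ω} ≤ t ^ θ * ((∫⁻ ω, X ω ^ (-θ) ∂μ) * ∫⁻ ω, W ω ∂μ) := by
  have hXθ : AEMeasurable (fun ω => X ω ^ (-θ)) μ := hX.pow_const _
  have hprod : AEMeasurable (fun ω => X ω ^ (-θ) * W ω) μ := hXθ.mul hW
  have hindθ : IndepFun (fun ω => X ω ^ (-θ)) W μ :=
    hind.comp (φ := fun x => x ^ (-θ)) (by fun_prop) measurable_id
  rw [← lintegral_mul_eq_lintegral_mul_lintegral_of_indepFun'' hXθ hW hindθ,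
    ← lintegral_const_mul'' _ hprod]
  refine le_trans (measure_mono_ae ?_) ((meas_ge_le_lintegral_div (hprod.const_mul (t ^ θ))
    one_ne_zero ENNReal.one_ne_top).trans_eq (div_one _))
  filter_upwards [hfin] with ω hω hle
  have hWθ : W ω ^ θ ≤ W ω := by
    simpa using ENNReal.rpow_le_rpow_of_exponent_le (hone ω) hθ₁
  change 1 ≤ t ^ θ * (X ω ^ (-θ) * W ω)
  rcases eq_or_ne (X ω) 0 with h0 | h0
  · have hW0 : W ω ≠ 0 := (one_pos.trans_le (hone ω)).ne'
    rw [h0, ENNReal.zero_rpow_of_neg (neg_lt_zero.2 hθ), ENNReal.top_mul hW0,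
      ENNReal.mul_top (by simp [ENNReal.rpow_eq_zero_iff, ht, hθ.not_gt])]
    exact le_top
  · calc (1 : ℝ≥0∞) = X ω ^ θ * X ω ^ (-θ) := by
          rw [← ENNReal.rpow_add _ _ h0 hω, add_neg_cancel, ENNReal.rpow_zero]
      _ ≤ (t * W ω) ^ θ * X ω ^ (-θ) := by gcongr; exact hle
      _ = t ^ θ * (X ω ^ (-θ) * W ω ^ θ) := by
          rw [ENNReal.mul_rpow_of_nonneg _ _ hθ.le, mul_assoc, mul_comm (W ω ^ θ)]
      _ ≤ t ^ θ * (X ω ^ (-θ) * W ω) := by gcongr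

end Diversity

section Model

theorem ae_comp_of_hasLaw {Ω 𝓧 : Type*} [MeasurableSpace Ω] [MeasurableSpace 𝓧] {X : Ω → 𝓧}
    {ν : Measure 𝓧} {μ : Measure Ω} (hX : HasLaw X ν μ) {p : 𝓧 → Prop} (hp : ∀ᵐ x ∂ν, p x) :
    ∀ᵐ ω ∂μ, p (X ω) :=
  ae_of_ae_map hX.aemeasurable (hX.map_eq.symm ▸ hp)

theorem isProbabilityMeasure_cond_innerDisc {r₁ : ℝ} (h₁ : 0 < r₁) :
    IsProbabilityMeasure ((volume : Measure Plane)[|innerDisc r₁]) :=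
  cond_isProbabilityMeasure_of_finite (Metric.measure_closedBall_pos _ _ h₁).ne'
    measure_closedBall_lt_top.ne

theorem isProbabilityMeasure_cond_outerRing {r₁ r : ℝ} (h₁ : 0 ≤ r₁) (hr : r₁ < r) :
    IsProbabilityMeasure ((volume : Measure Plane)[|outerRing r₁ r]) := by
  refine cond_isProbabilityMeasure_of_finite ?_
    (measure_ne_top_of_subset Set.sdiff_subset measure_closedBall_lt_top.ne)
  have hopen : IsOpen (Metric.ball (0 : Plane) r \ Metric.closedBall 0 r₁) :=
    Metric.isOpen_ball.sdiff Metric.isClosed_closedBall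
  obtain ⟨p, hp⟩ := exists_norm_eq Plane (c := (r₁ + r) / 2) (by linarith)
  have hne : (Metric.ball (0 : Plane) r \ Metric.closedBall 0 r₁).Nonempty :=
    ⟨p, by simp only [Metric.mem_ball, dist_zero_right]; linarith,
      by simp only [Metric.mem_closedBall, dist_zero_right]; linarith⟩
  exact ((hopen.measure_pos volume hne).trans_le
    (measure_mono (Set.sdiff_subset_sdiff_left Metric.ball_subset_closedBall))).ne'

theorem ae_norm_le_cond_outerRing (r₁ r : ℝ) :
    ∀ᵐ p ∂(volume : Measure Plane)[|outerRing r₁ r], ‖p‖ ≤ r := by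
  have hm : MeasurableSet (outerRing r₁ r) :=
    Metric.isClosed_closedBall.measurableSet.diff Metric.isClosed_closedBall.measurableSet
  filter_upwards [ae_cond_mem hm] with p hp
  simpa using hp.1

variable {M N : ℕ} {r₁ r : ℝ}

/-- The values of all random quantities except the interferers. -/
abbrev CellData (M N : ℕ) : Type :=
  (Fin M → Channel N M) × (Fin M → Channel N M) × (Fin M → Plane) × (Fin M → Plane) ×
    (Fin M → Fin (2 * N - M) → ℂ)

/-- The joint law of all random quantities except the interferers. -/
noncomputable abbrev cellLaw (M N : ℕ) (r₁ r : ℝ) : Measure (CellData M N) :=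
  (Measure.pi fun _ => rayleigh N M).prod <|
    (Measure.pi fun _ => rayleigh N M).prod <|
    (Measure.pi fun _ => (volume : Measure Plane)[|innerDisc r₁]).prod <|
    (Measure.pi fun _ => (volume : Measure Plane)[|outerRing r₁ r]).prod <|
    Measure.pi fun _ => uniformSphere (2 * N - M)

/-- The random quantities of the pairs, regrouped pair by pair and without the locations. -/
def cellPairs (q : CellData M N) (i : Fin M) : PairData M N := (q.1 i, q.2.1 i, q.2.2.2.2 i)

theorem measurePreserving_cellPairs (h₁ : 0 < r₁) (hr : r₁ < r) :
    MeasurePreserving cellPairs (cellLaw M N r₁ r) (Measure.pi fun _ => pairLaw M N) := by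
  have := isProbabilityMeasure_cond_innerDisc h₁
  have := isProbabilityMeasure_cond_outerRing h₁.le hr
  have hinner := (measurePreserving_arrowProdEquivProdArrow (Channel N M)
    (Fin (2 * N - M) → ℂ) (Fin M) (fun _ => rayleigh N M)
    (fun _ => uniformSphere (2 * N - M))).symm
  have houter := (measurePreserving_arrowProdEquivProdArrow (Channel N M)
    (Channel N M × (Fin (2 * N - M) → ℂ)) (Fin M) (fun _ => rayleigh N M)
    (fun _ => (rayleigh N M).prod (uniformSphere (2 * N - M)))).symm
  exact (houter.comp ((MeasurePreserving.id _).prod hinner)).comp ((MeasurePreserving.id _).prod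
    ((MeasurePreserving.id _).prod (measurePreserving_snd.comp measurePreserving_snd)))

theorem measurePreserving_cell_far (h₁ : 0 < r₁) (hr : r₁ < r) (m : Fin M) :
    MeasurePreserving (fun q : CellData M N => q.2.2.2.1 m) (cellLaw M N r₁ r)
      ((volume : Measure Plane)[|outerRing r₁ r]) := by
  have := isProbabilityMeasure_cond_innerDisc h₁
  have := isProbabilityMeasure_cond_outerRing h₁.le hr
  exact (measurePreserving_eval (fun _ : Fin M => (volume : Measure Plane)[|outerRing r₁ r])
    m).comp (measurePreserving_fst.comp (measurePreserving_snd.comp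
      (measurePreserving_snd.comp measurePreserving_snd)))

variable {Ω : Type*} [MeasurableSpace Ω] {μ : Measure Ω} {S : Downlink M N Ω} {lam : ℝ≥0}

/-- The random quantities of the pairs at `ω`. -/
def Downlink.pairs (S : Downlink M N Ω) (ω : Ω) : Fin M → PairData M N := cellPairs (S.cell ω)

theorem Downlink.IsModel.hasLaw_pairs (hS : S.IsModel μ r₁ r lam) (h₁ : 0 < r₁) (hr : r₁ < r) :
    HasLaw S.pairs (Measure.pi fun _ => pairLaw M N) μ :=
  (measurePreserving_cellPairs h₁ hr).hasLaw.comp hS.law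

theorem Downlink.IsModel.isProbabilityMeasure (hS : S.IsModel μ r₁ r lam) (h₁ : 0 < r₁)
    (hr : r₁ < r) : IsProbabilityMeasure μ :=
  (hS.hasLaw_pairs h₁ hr).isProbabilityMeasure_iff.2 inferInstance

theorem Downlink.IsModel.indepFun_pairs (hS : S.IsModel μ r₁ r lam) (h₁ : 0 < r₁) (hr : r₁ < r) :
    IndepFun S.pairs (fun ω => points (S.Ψ ω)) μ :=
  hS.indep.comp (measurePreserving_cellPairs h₁ hr).measurable measurable_id

theorem Downlink.IsModel.ae_norm_far_le (hS : S.IsModel μ r₁ r lam) (h₁ : 0 < r₁) (hr : r₁ < r)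
    (m : Fin M) : ∀ᵐ ω ∂μ, ‖S.p' ω m‖ ≤ r :=
  ae_comp_of_hasLaw hS.law ((measurePreserving_cell_far h₁ hr m).quasiMeasurePreserving.ae
    (ae_norm_le_cond_outerRing r₁ r))

end Model

section FarUser

theorem norm_sum_star_sq_le {ι : Type*} [Fintype ι] (v : ι → ℂ) :
    ‖∑ i, star (v i)‖ ^ 2 ≤ Fintype.card ι * normSq v := by
  have h := norm_sq_star_dotProduct_le v fun _ => 1
  simp only [dotProduct, Pi.star_apply, mul_one] at h
  refine h.trans_eq ?_
  simp [normSq, mul_comm]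

variable {M N : ℕ} {Ω : Type*} {S : Downlink M N Ω} {r₀ r₁ r α ρI a a' R : ℝ} {lam : ℝ≥0}
  {U : Fin M → Channel N M → Channel N M → Matrix (Fin N ⊕ Fin N) (Fin (2 * N - M)) ℂ}

theorem ae_normSq_pairFar_le (hMN : M < 2 * N) (hU : ∀ i, IsAlignment (U i)) (m : Fin M) :
    ∀ᵐ y ∂Measure.pi fun _ => pairLaw M N, normSq (pairFar (U m) (y m)) ≤ 2 := by
  have hsphere : MeasurePreserving (fun y : Fin M → PairData M N => (y m).2.2)
      (Measure.pi fun _ => pairLaw M N) (uniformSphere (2 * N - M)) :=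
    (measurePreserving_snd.comp measurePreserving_snd).comp
      (measurePreserving_eval (fun _ : Fin M => pairLaw M N) m)
  have hk : 0 < 2 * N - M := by lia
  filter_upwards [hsphere.quasiMeasurePreserving.ae (ae_normSq_uniformSphere hk)] with y hy
  exact (normSq_pairFar_le (hU m) _).trans hy.le

theorem Downlink.farChannel_eq_scalarGain (S : Downlink M N Ω)
    (U : Fin M → Channel N M → Channel N M → Matrix (Fin N ⊕ Fin N) (Fin (2 * N - M)) ℂ)
    (r₀ α : ℝ) (m : Fin M) (ω : Ω) : S.farChannel U r₀ α m ω =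
      scalarGain r₀ α (dist (S.p' ω m) 0) (zfGain U m (S.pairs ω))⁻¹ :=
  congrArg _ (zfDiag_eq_inv_zfGain _ _ _ m)

variable [MeasurableSpace Ω] {μ : Measure Ω}

/-- The outage probability of the far user for a random noise power `w`. -/
noncomputable def Downlink.outageProb (S : Downlink M N Ω)
    (U : Fin M → Channel N M → Channel N M → Matrix (Fin N ⊕ Fin N) (Fin (2 * N - M)) ℂ)
    (μ : Measure Ω) (r₀ α a a' R : ℝ) (m : Fin M) (w : Ω → ℝ) (ρ : ℝ) : ℝ :=
  μ.real {ω | Real.logb 2 (1 + sinr a a' ρ (S.farChannel U r₀ α m ω) (w ω)) < R}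

theorem Downlink.IsModel.ae_normSq_pairFar_pos (hS : S.IsModel μ r₁ r lam) (hMN : M < 2 * N)
    (h₁ : 0 < r₁) (hr : r₁ < r) (hU : ∀ i, IsAlignment (U i)) (m : Fin M) :
    ∀ᵐ ω ∂μ, 0 < normSq (pairFar (U m) (S.pairs ω m)) := by
  filter_upwards [ae_comp_of_hasLaw (hS.hasLaw_pairs h₁ hr) (ae_det_pairsMatrix_ne_zero hMN hU)]
    with ω hω
  exact normSq_pos (pairFar_ne_zero_of_det_ne_zero hU hω m)

theorem Downlink.IsModel.exists_ae_outage_thresholds (hS : S.IsModel μ r₁ r lam) (hr₀ : 0 < r₀)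
    (h₁ : 0 < r₁) (hr : r₁ < r) (α : ℝ) (m : Fin M) (hR : 0 < R)
    (hcond : a ^ 2 * (2 ^ R - 1) < a' ^ 2) :
    ∃ κ K : ℝ, 0 < κ ∧ 0 < K ∧ ∀ᵐ ω ∂μ, ∀ ρ w, 0 < ρ → 0 < w →
      (zfGain U m (S.pairs ω) < κ / ρ * w →
        Real.logb 2 (1 + sinr a a' ρ (S.farChannel U r₀ α m ω) w) < R) ∧
      (Real.logb 2 (1 + sinr a a' ρ (S.farChannel U r₀ α m ω) w) < R →
        zfGain U m (S.pairs ω) < K / ρ * w) := by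
  obtain ⟨κ, K, hκ, hK, h⟩ := exists_outage_thresholds hr₀ hR hcond α r
  refine ⟨κ, K, hκ, hK, ?_⟩
  filter_upwards [hS.ae_norm_far_le h₁ hr m] with ω hω ρ w hρ hw
  rw [S.farChannel_eq_scalarGain, div_mul_eq_mul_div, div_mul_eq_mul_div, lt_div_iff₀' hρ,
    lt_div_iff₀' hρ]
  exact h _ ⟨dist_nonneg, by rwa [dist_zero_right]⟩ ρ _ w hρ.le (zfGain_nonneg m _) hw

theorem Downlink.IsModel.exists_le_outageProb (hS : S.IsModel μ r₁ r lam)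
    (hMN : M < 2 * N) (hr₀ : 0 < r₀) (h₁ : 0 < r₁) (hr : r₁ < r) (α : ℝ)
    (hU : ∀ i, IsAlignment (U i)) (m : Fin M) (hR : 0 < R)
    (hcond : a ^ 2 * (2 ^ R - 1) < a' ^ 2) {w : Ω → ℝ}
    (hw : ∀ᵐ ω ∂μ, normSq (pairFar (U m) (S.pairs ω m)) ≤ w ω) :
    ∃ c : ℝ, 0 < c ∧ ∀ᶠ ρ : ℝ in atTop,
      c * ρ ^ (-1 : ℝ) ≤ S.outageProb U μ r₀ α a a' R m w ρ := by
  have := hS.isProbabilityMeasure h₁ hr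
  obtain ⟨δ, hδ, hsmall⟩ := exists_le_zfGain_lt hMN hU m
  obtain ⟨κ, K, hκ, -, hthr⟩ :=
    hS.exists_ae_outage_thresholds (U := U) hr₀ h₁ hr α m hR hcond
  have hδ' : δ ≠ ∞ := by
    refine ne_top_of_le_ne_top (measure_ne_top _ _) (le_trans ?_ (hsmall 1 zero_le_one le_rfl))
    simp
  refine ⟨κ * δ.toReal, mul_pos hκ (ENNReal.toReal_pos hδ.ne' hδ'), ?_⟩
  filter_upwards [eventually_ge_atTop κ, eventually_gt_atTop 0] with ρ hκρ hρ
  have houtage : μ {ω | zfGain U m (S.pairs ω) < κ / ρ * normSq (pairFar (U m) (S.pairs ω m))} ≤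
      μ {ω | Real.logb 2 (1 + sinr a a' ρ (S.farChannel U r₀ α m ω) (w ω)) < R} := by
    refine measure_mono_ae ?_
    filter_upwards [hw, hthr, hS.ae_normSq_pairFar_pos hMN h₁ hr hU m] with ω hω hthrω hpos hlt
    refine (hthrω ρ (w ω) hρ (hpos.trans_le hω)).1 (hlt.trans_le ?_)
    gcongr
  rw [(hS.hasLaw_pairs h₁ hr).measure_eq
    (p := fun y => zfGain U m y < κ / ρ * normSq (pairFar (U m) (y m)))
    (measurableSet_zfGain_lt hU m _)] at houtage
  have hle := (hsmall (κ / ρ) (by positivity) ((div_le_one hρ).2 hκρ)).trans houtage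
  calc κ * δ.toReal * ρ ^ (-1 : ℝ) = (ENNReal.ofReal (κ / ρ) * δ).toReal := by
        rw [ENNReal.toReal_mul, ENNReal.toReal_ofReal (by positivity), Real.rpow_neg_one]
        ring
    _ ≤ S.outageProb U μ r₀ α a a' R m w ρ := ENNReal.toReal_mono (measure_ne_top _ _) hle

theorem Downlink.IsModel.lintegral_rpow_neg_zfGain_lt_top (hS : S.IsModel μ r₁ r lam)
    (hMN : M < 2 * N) (h₁ : 0 < r₁) (hr : r₁ < r) (hU : ∀ i, IsAlignment (U i)) (m : Fin M)
    {θ : ℝ} (hθ : 0 ≤ θ) (hθ₁ : θ < 1) :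
    ∫⁻ ω, ENNReal.ofReal (zfGain U m (S.pairs ω)) ^ (-θ) ∂μ < ∞ := by
  rw [(hS.hasLaw_pairs h₁ hr).lintegral_comp
    (f := fun y => ENNReal.ofReal (zfGain U m y) ^ (-θ))
    ((measurable_zfGain hU m).ennreal_ofReal.pow_const _).aemeasurable]
  exact MimoNoma.lintegral_rpow_neg_zfGain_lt_top hMN hU m hθ hθ₁

theorem Downlink.IsModel.exists_outageProb_le (hS : S.IsModel μ r₁ r lam)
    (hMN : M < 2 * N) (hr₀ : 0 < r₀) (h₁ : 0 < r₁) (hr : r₁ < r) (α : ℝ)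
    (hU : ∀ i, IsAlignment (U i)) (m : Fin M) (hR : 0 < R)
    (hcond : a ^ 2 * (2 ^ R - 1) < a' ^ 2) {w : Ω → ℝ} (hw : ∀ᵐ ω ∂μ, 0 < w ω)
    {W : Measure Plane → ℝ≥0∞} (hW : Measurable W) (hone : ∀ ν, 1 ≤ W ν)
    (hfin : ∫⁻ ω, W (points (S.Ψ ω)) ∂μ < ∞)
    (hwW : ∀ᵐ ω ∂μ, ENNReal.ofReal (w ω) ≤ W (points (S.Ψ ω)))
    {θ : ℝ} (hθ : 0 < θ) (hθ₁ : θ < 1) :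
    ∃ C : ℝ, ∀ ρ : ℝ, 0 < ρ → S.outageProb U μ r₀ α a a' R m w ρ ≤ C * ρ ^ (-θ) := by
  obtain ⟨κ, K, -, hK, hthr⟩ :=
    hS.exists_ae_outage_thresholds (U := U) hr₀ h₁ hr α m hR hcond
  have hlaw := hS.hasLaw_pairs h₁ hr
  have hg : Measurable fun y => ENNReal.ofReal (zfGain U m y) :=
    (measurable_zfGain hU m).ennreal_ofReal
  set A := (∫⁻ ω, ENNReal.ofReal (zfGain U m (S.pairs ω)) ^ (-θ) ∂μ) *
    ∫⁻ ω, W (points (S.Ψ ω)) ∂μ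
  have hA : A ≠ ∞ :=
    (ENNReal.mul_lt_top (hS.lintegral_rpow_neg_zfGain_lt_top hMN h₁ hr hU m hθ.le hθ₁) hfin).ne
  refine ⟨K ^ θ * A.toReal, fun ρ hρ => ?_⟩
  have hKρ : 0 < K / ρ := by positivity
  have hmarkov : μ {ω | ENNReal.ofReal (zfGain U m (S.pairs ω)) ≤
      ENNReal.ofReal (K / ρ) * W (points (S.Ψ ω))} ≤ ENNReal.ofReal (K / ρ) ^ θ * A :=
    measure_le_mul_le_rpow_mul_lintegral (hg.comp_aemeasurable hlaw.aemeasurable)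
      (hW.comp hS.poisson.measurable).aemeasurable ((hS.indepFun_pairs h₁ hr).comp hg hW)
      (ae_of_all _ fun _ => ENNReal.ofReal_ne_top) (fun _ => hone _) hθ hθ₁.le
      (ENNReal.ofReal_pos.2 hKρ).ne'
  have houtage : μ {ω | Real.logb 2 (1 + sinr a a' ρ (S.farChannel U r₀ α m ω) (w ω)) < R} ≤
      ENNReal.ofReal (K / ρ) ^ θ * A := by
    refine (measure_mono_ae ?_).trans hmarkov
    filter_upwards [hw, hwW, hthr] with ω hω hωW hthrω hout
    refine (ENNReal.ofReal_le_ofReal ((hthrω ρ (w ω) hρ hω).2 hout).le).trans ?_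
    rw [ENNReal.ofReal_mul hKρ.le]
    gcongr
  calc S.outageProb U μ r₀ α a a' R m w ρ ≤ (ENNReal.ofReal (K / ρ) ^ θ * A).toReal :=
        ENNReal.toReal_mono (ENNReal.mul_ne_top (ENNReal.rpow_ne_top_of_nonneg hθ.le
          ENNReal.ofReal_ne_top) hA) houtage
    _ = K ^ θ * A.toReal * ρ ^ (-θ) := by
        rw [ENNReal.toReal_mul, ← ENNReal.toReal_rpow, ENNReal.toReal_ofReal hKρ.le,
          Real.div_rpow hK.le hρ.le, Real.rpow_neg hρ.le]
        ring

theorem Downlink.IsModel.exists_ofReal_noise_le (hS : S.IsModel μ r₁ r lam)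
    (hr₀ : 0 < r₀) (h₁ : 0 < r₁) (hr : r₁ < r) (hρI : 0 ≤ ρI) (hα : 0 < ρI → 2 < α) (m : Fin M)
    {δ : ℝ} (hδ : 0 ≤ δ) :
    ∃ W : Measure Plane → ℝ≥0∞, Measurable W ∧ (∀ ν, 1 ≤ W ν) ∧
      ∫⁻ ω, W (points (S.Ψ ω)) ∂μ < ∞ ∧ ∀ᵐ ω ∂μ,
        ENNReal.ofReal (2 + 2 * δ * S.farInterference r₀ α ρI m ω) ≤ W (points (S.Ψ ω)) := by
  have := hS.isProbabilityMeasure h₁ hr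
  obtain ⟨J, hJ, hJfin, hle⟩ := hS.poisson.exists_interference_le hr₀ hρI hα r
  refine ⟨fun ν => 2 + ENNReal.ofReal (2 * δ) * J ν, measurable_const.add (hJ.const_mul _),
    fun ν => one_le_two.trans le_self_add, ?_, ?_⟩
  · have hJΨ : Measurable fun ω => J (points (S.Ψ ω)) := hJ.comp hS.poisson.measurable
    rw [lintegral_add_left measurable_const, lintegral_const_mul _ hJΨ, lintegral_const]
    exact ENNReal.add_lt_top.2 ⟨ENNReal.mul_lt_top (by simp) (measure_lt_top _ _),
      ENNReal.mul_lt_top ENNReal.ofReal_lt_top hJfin⟩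
  · filter_upwards [hS.ae_norm_far_le h₁ hr m] with ω hω
    have hI : 0 ≤ S.farInterference r₀ α ρI m ω := ENNReal.toReal_nonneg
    rw [ENNReal.ofReal_add zero_le_two (by positivity), ENNReal.ofReal_mul (by positivity),
      ENNReal.ofReal_ofNat]
    gcongr
    exact ENNReal.ofReal_toReal_le.trans (hle _ _ hω)

theorem Downlink.IsModel.hasDiversityOrder_outageProb
    (hS : S.IsModel μ r₁ r lam) (hMN : M < 2 * N) (hr₀ : 0 < r₀) (h₁ : 0 < r₁) (hr : r₁ < r)
    (hρI : 0 ≤ ρI) (hα : 0 < ρI → 2 < α) (hU : ∀ i, IsAlignment (U i)) (m : Fin M)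
    (hR : 0 < R) (hcond : a ^ 2 * (2 ^ R - 1) < a' ^ 2) {w : Ω → ℝ} {δ : ℝ} (hδ : 0 ≤ δ)
    (hlow : ∀ᵐ ω ∂μ, normSq (pairFar (U m) (S.pairs ω m)) ≤ w ω)
    (hup : ∀ᵐ ω ∂μ, w ω ≤ 2 + 2 * δ * S.farInterference r₀ α ρI m ω) :
    HasDiversityOrder (S.outageProb U μ r₀ α a a' R m w) 1 := by
  obtain ⟨c, hc, hbelow⟩ := hS.exists_le_outageProb hMN hr₀ h₁ hr α hU m hR hcond hlow
  obtain ⟨W, hW, hone, hfin, hnoise⟩ := hS.exists_ofReal_noise_le hr₀ h₁ hr hρI hα m hδ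
  refine hasDiversityOrder_of_bounds hc hbelow ?_
  filter_upwards [Ioo_mem_nhdsLT (zero_lt_one' ℝ)] with θ hθ
  have hpos : ∀ᵐ ω ∂μ, 0 < w ω := by
    filter_upwards [hlow, hS.ae_normSq_pairFar_pos hMN h₁ hr hU m] with ω hω hfar
    exact hfar.trans_le hω
  have hwW : ∀ᵐ ω ∂μ, ENNReal.ofReal (w ω) ≤ W (points (S.Ψ ω)) := by
    filter_upwards [hup, hnoise] with ω hω hωW
    exact (ENNReal.ofReal_le_ofReal hω).trans hωW
  obtain ⟨C, hC⟩ := hS.exists_outageProb_le hMN hr₀ h₁ hr α hU m hR hcond hpos hW hone hfin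
    hwW hθ.1 hθ.2
  exact ⟨C, (eventually_gt_atTop 0).mono hC⟩

end FarUser

end MimoNoma

theorem corollary1_general {Ω : Type*} [MeasurableSpace Ω] (μ : Measure Ω)
    {M N : ℕ} (hMN : M < 2 * N) (r₀ r₁ r α : ℝ) (hr₀ : 0 < r₀) (h₁ : 0 < r₁) (hr₁ : r₁ < r)
    (lam : NNReal) (ρI : ℝ) (hρI : 0 ≤ ρI) (hαI : 0 < ρI → 2 < α)
    (U : Fin M → MimoNoma.Channel N M → MimoNoma.Channel N M →
      Matrix (Fin N ⊕ Fin N) (Fin (2 * N - M)) ℂ)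
    (hU : ∀ i, MimoNoma.IsAlignment (U i))
    (S : MimoNoma.Downlink M N Ω) (hS : S.IsModel μ r₁ r lam)
    (m : Fin M) (a a' R : ℝ) (hR : 0 < R) (hcond : a ^ 2 * ((2 : ℝ) ^ R - 1) < a' ^ 2) :
    MimoNoma.HasDiversityOrder (S.farOutage U μ r₀ α ρI a a' R m) 1 ∧
      ∀ δ : ℝ, 0 ≤ δ →
        MimoNoma.HasDiversityOrder (S.farOutageMod U μ r₀ α ρI a a' R δ m) 1 := by
  have hfar : ∀ᵐ ω ∂μ, MimoNoma.normSq (S.farDetector U m ω) ≤ 2 :=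
    MimoNoma.ae_comp_of_hasLaw (hS.hasLaw_pairs h₁ hr₁) (MimoNoma.ae_normSq_pairFar_le hMN hU m)
  have hI (ω : Ω) : 0 ≤ S.farInterference r₀ α ρI m ω := ENNReal.toReal_nonneg
  refine ⟨hS.hasDiversityOrder_outageProb hMN hr₀ h₁ hr₁ hρI hαI hU m hR hcond (Nat.cast_nonneg N)
    (ae_of_all _ fun ω => le_add_of_nonneg_right (mul_nonneg (sq_nonneg _) (hI ω))) ?_,
    fun δ hδ => hS.hasDiversityOrder_outageProb hMN hr₀ h₁ hr₁ hρI hαI hU m hR hcond hδ ?_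
      (ae_of_all _ fun ω => le_rfl)⟩
  · filter_upwards [hfar] with ω hω
    have hsum : ‖∑ n, star (S.farDetector U m ω n)‖ ^ 2 ≤ N * 2 := by
      simpa using (MimoNoma.norm_sum_star_sq_le _).trans (mul_le_mul_of_nonneg_left hω (by simp))
    exact add_le_add hω (mul_le_mul_of_nonneg_right (by linarith) (hI ω))
  · filter_upwards [hfar] with ω hω
    exact hω.trans (le_add_of_nonneg_right (mul_nonneg (by positivity) (hI ω)))

theorem corollary1 {Ω : Type*} [MeasurableSpace Ω] (μ : MeasureTheory.Measure Ω)
    [MeasureTheory.IsProbabilityMeasure μ]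
    {M N : ℕ} (hMN : M < 2 * N)
    (r₀ r₁ r α : ℝ) (hr₀ : 0 < r₀) (hr₀₁ : r₀ ≤ r₁) (hr₁ : r₁ < r) (hα : 0 < α)
    (lam : NNReal) (ρI : ℝ) (hρI : 0 ≤ ρI) (hαI : 0 < ρI → 2 < α)
    (U : Fin M → MimoNoma.Channel N M → MimoNoma.Channel N M →
      Matrix (Fin N ⊕ Fin N) (Fin (2 * N - M)) ℂ)
    (hU : ∀ i, MimoNoma.IsAlignment (U i))
    (S : MimoNoma.Downlink M N Ω) (hS : S.IsModel μ r₁ r lam)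
    (m : Fin M) (a a' R : ℝ) (hpow : a ^ 2 + a' ^ 2 = 1) (hR : 0 < R)
    (hcond : a ^ 2 * ((2 : ℝ) ^ R - 1) < a' ^ 2) :
    MimoNoma.HasDiversityOrder (S.farOutage U μ r₀ α ρI a a' R m) 1 ∧
      ∀ δ : ℝ, 0 ≤ δ →
        MimoNoma.HasDiversityOrder (S.farOutageMod U μ r₀ α ρI a a' R δ m) 1 := by
  exact corollary1_general μ hMN r₀ r₁ r α hr₀ (hr₀.trans_le hr₀₁) hr₁ lam ρI hρI hαI U hU S hS
    m a a' R hR hcond
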